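/- **Notation.** Let $\mathbb D=\{z\in\mathbb C:|z|<1\}$, $\overline{\mathbb D}$ its closure, $\mathbb T=b\mathbb D$ the unit circle, $\mathbb C^2_*=\mathbb C^2\setminus\{0\}$, $|\cdot|$ the Euclidean norm on $\mathbb C^2$, $b\mathbb B^2=\{w\in\mathbb C^2:|w|=1\}$, and let $\sigma\colon\mathbb C^2_*\to\mathbb{CP}^1$ be the projection sending $w$ to the complex line $\mathbb Cw$. A map on $\overline{\mathbb D}$ is of class $\mathscr A^\infty(\mathbb D)$ if it is $\mathscr C^\infty$ on $\overline{\mathbb D}$ (up to the boundary) and holomorphic on $\mathbb D$. Let $\mathscr H^+_*$ be the set of all functions $h=u+iv\in\mathscr A^\infty(\mathbb D)$ (with $u,v$ real), not identically zero, such that $h(\bar z)=\overline{h(z)}$ and $u(z)\ge 0$ for all $z\in\overline{\mathbb D}$, and $u|_{\mathbb T}=0$ in a neighbourhood of the points $\pm1$ in $\mathbb T$. **Lemma 3.1.** Let $f=(f_1,f_2)\colon\overline{\mathbb D}\to\mathbb C^2_*$ be a map of class $\mathscr A^\infty(\mathbb D)$ such that (a) $|f|^2=|f_1|^2+|f_2|^2\le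 1$ on $(-1,1)=\mathbb D\cap\mathbb R$, (b) $|f|>1$ on $\mathbb T\setminus\{\pm1\}$, and (c) $\sigma\circ f\colon\overline{\mathbb D}\to\mathbb{CP}^1$ is an immersion (also at the boundary points of $\overline{\mathbb D}$). Let $E\subset b\mathbb B^2$ be a smoothly embedded compact curve, that is, a compact embedded $\mathscr C^\infty$ submanifold of dimension one, possibly with end points and not necessarily connected, such that $f(1)\notin E$ and $f(-1)\notin E$. Let $\eta\in(0,1)$. Then for every $\epsilon>0$ there is a function $h\in\mathscr H^+_*$ with $|h(z)|+\|dh_z\|<\epsilon$ for all $z\in\overline{\mathbb D}$ (so $h$ can be chosen arbitrarily close to $0$ in $\mathscr C^1(\overline{\mathbb D})$) such that the map $f_h:=e^{-h}f\colon\overline{\mathbb D}\to\mathbb C^2_*$ is an immersion and satisfies the following conditions: (1) $|f_h|<1$ on $(-1,1)$, and $|f_h|>(1-\eta)|f|+\eta>1$ on $\mathbb T\setminus\{\pm1\}$; (2) $f_h$ is transverse to $b\mathbb B^2$: for every $z\in\overline{\mathbb D}$ with $|f_h(z)|=1$, the image of the real differential of $f_h$ at $z$ and the tangent space $T_{f_h(z)}b\mathbb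 B^2$ together span $\mathbb C^2$ over $\mathbb R$; (3) $f_h(\overline{\mathbb D})\cap E=\varnothing$. -/

import Mathlib

open Set Filter Topology Metric
open scoped ContDiff ComplexConjugate

noncomputable section

namespace DiscPosition

/-- The space `ℂ²` with its standard Hermitian norm. -/
abbrev C2 : Type := EuclideanSpace ℂ (Fin 2)

/-- The closed unit disc in `ℂ`. -/
abbrev cDisc : Set ℂ := closedBall (0 : ℂ) 1

/-- The unit circle in `ℂ`. -/
abbrev circ : Set ℂ := sphere (0 : ℂ) 1

/-- The unit sphere of `ℂ²`, the boundary of the unit ball. -/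
abbrev S3 : Set C2 := sphere (0 : C2) 1

/-- The class `𝒜^∞` of the disc: smooth (in the real sense) on the closed disc, up to the boundary,
and holomorphic in the open disc. Only the values on the closed disc matter. -/
def IsAInfty {V : Type*} [NormedAddCommGroup V] [NormedSpace ℝ V] [NormedSpace ℂ V]
    (f : ℂ → V) : Prop :=
  ContDiffOn ℝ ∞ f cDisc ∧ DifferentiableOn ℂ f (ball (0 : ℂ) 1)

/-- The space `ℋ`: functions `h = u + iv` of class `𝒜^∞` with `h (conj z) = conj (h z)`, such that
`u` restricted to the circle vanishes near `1` and near `-1`. -/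
def MemH (h : ℂ → ℂ) : Prop :=
  IsAInfty h ∧ (∀ z ∈ cDisc, h (conj z) = conj (h z)) ∧
    (∀ᶠ z in 𝓝[circ] (1 : ℂ), (h z).re = 0) ∧ (∀ᶠ z in 𝓝[circ] (-1 : ℂ), (h z).re = 0)

/-- The cone `ℋ⁺_*`: elements of `ℋ` with nonnegative real part that are not identically zero on
the closed disc. -/
def MemHPlusStar (h : ℂ → ℂ) : Prop :=
  MemH h ∧ (∀ z ∈ cDisc, 0 ≤ (h z).re) ∧ ∃ z ∈ cDisc, h z ≠ 0

/-- `h` is `ε`-close to `0` in `𝒞¹` of the closed disc (first derivatives on the boundary are the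
one-sided ones). -/
def C1Small (h : ℂ → ℂ) (ε : ℝ) : Prop :=
  ∀ z ∈ cDisc, ‖h z‖ + ‖fderivWithin ℝ h cDisc z‖ < ε

/-- The complex projective line, the space of complex lines in `ℂ²`. -/
abbrev P1 : Type := Projectivization ℂ C2

theorem e0_ne_zero : (EuclideanSpace.single 0 1 : C2) ≠ 0 := by
  simp

open Classical in
/-- The projection `σ : ℂ² ∖ {0} → ℂℙ¹`, sending `w` to the complex line through `0` and `w`
(with an irrelevant value at `w = 0`). -/
def sigma (w : C2) : P1 :=
  if hw : w ≠ 0 then Projectivization.mk ℂ w hw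
  else Projectivization.mk ℂ (EuclideanSpace.single 0 1) e0_ne_zero

/-- The domain `{[w₀ : w₁] | wᵢ ≠ 0}` of the `i`-th standard affine chart of `ℂℙ¹`. -/
def affineDom (i : Fin 2) : Set P1 := {p | p.rep i ≠ 0}

/-- The `i`-th standard affine coordinate of `ℂℙ¹`: `w₁ / w₀` for `i = 0` and `w₀ / w₁` for
`i = 1`. -/
def affineCoord (i : Fin 2) (p : P1) : ℂ := p.rep (1 - i) / p.rep i

theorem sigma_mem_affineDom {w : C2} (hw : w ≠ 0) (i : Fin 2) :
    sigma w ∈ affineDom i ↔ w i ≠ 0 := by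
  obtain ⟨a, ha⟩ := Projectivization.exists_smul_eq_mk_rep ℂ w hw
  have h2 : (a : ℂ) ≠ 0 := a.ne_zero
  simp only [sigma, affineDom, dif_pos hw, mem_ofPred_eq, ← ha, Units.smul_def, PiLp.smul_apply,
    smul_eq_mul]
  simp [h2]

theorem affineCoord_sigma {w : C2} (hw : w ≠ 0) (i : Fin 2) :
    affineCoord i (sigma w) = w (1 - i) / w i := by
  obtain ⟨a, ha⟩ := Projectivization.exists_smul_eq_mk_rep ℂ w hw
  have h2 : (a : ℂ) ≠ 0 := a.ne_zero
  simp only [sigma, affineCoord, dif_pos hw, ← ha, Units.smul_def, PiLp.smul_apply, smul_eq_mul]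
  exact mul_div_mul_left _ _ h2

/-- `g` is a smooth immersion of the closed disc into `ℂℙ¹`: in each affine chart around `g z`
(which `g` does not leave near `z`) it is smooth at `z` with injective real differential, at all
points `z` of the closed disc, those on the boundary included. -/
def IsImmersionP1 (g : ℂ → P1) : Prop :=
  ∀ z ∈ cDisc, ∀ i : Fin 2, g z ∈ affineDom i →
    (∀ᶠ z' in 𝓝[cDisc] z, g z' ∈ affineDom i) ∧
    ContDiffWithinAt ℝ ∞ (fun z' => affineCoord i (g z')) cDisc z ∧
    Function.Injective (fderivWithin ℝ (fun z' => affineCoord i (g z')) cDisc z)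

/-- `E` is a smoothly embedded curve (an embedded smooth submanifold of dimension one, possibly
with end points, not necessarily connected): near each of its points `p`, the set `E` is the image
of a smooth immersion `γ` of the interval `(-1, 1)` (interior points) or `[0, 1)` (end points),
with `γ 0 = p`, that is a homeomorphism onto its image. -/
def IsEmbeddedCurve {V : Type*} [NormedAddCommGroup V] [NormedSpace ℝ V] (E : Set V) : Prop :=
  ∀ p ∈ E, ∃ (U : Set V) (J : Set ℝ) (γ : ℝ → V),
    IsOpen U ∧ p ∈ U ∧ (J = Ioo (-1 : ℝ) 1 ∨ J = Ico (0 : ℝ) 1) ∧ γ 0 = p ∧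
    ContDiffOn ℝ ∞ γ J ∧ (∀ t ∈ J, derivWithin γ J t ≠ 0) ∧
    IsEmbedding (fun t : J => γ t) ∧ γ '' J = E ∩ U

/-- `F`, defined on the closed disc, is an immersion into `ℂ²`. -/
def IsImmersionC2 (F : ℂ → C2) : Prop :=
  ContDiffOn ℝ ∞ F cDisc ∧ ∀ z ∈ cDisc, Function.Injective (fderivWithin ℝ F cDisc z)

/-- The real tangent space at `p` of the unit sphere of `ℂ²`: the vectors that are orthogonal to `p`
for the real part of the Hermitian product. -/
def tangentS3 (p : C2) : Set C2 := {v | (inner ℂ p v).re = 0}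

/-- `F`, defined on the closed disc, is transverse to the unit sphere: at each point `z` of the
closed disc with `F z` in the sphere, the image of the differential of `F` and the tangent space of
the sphere span `ℂ²` over `ℝ`. -/
def IsTransverseS3 (F : ℂ → C2) : Prop :=
  ∀ z ∈ cDisc, F z ∈ S3 →
    ∀ w : C2, ∃ a : ℂ, ∃ v ∈ tangentS3 (F z), fderivWithin ℝ F cDisc z a + v = w

/-- The map `f_h = e^{-h} f`. -/
def twist (h : ℂ → ℂ) (f : ℂ → C2) (z : ℂ) : C2 := Complex.exp (-h z) • f z

end DiscPosition

end

namespace DiscPosition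

open MeasureTheory
open scoped NNReal ENNReal FourierTransform SchwartzMap

/-! The function `h` is sought as `t₁ * h₁ + t₂ * h₂` with small positive coefficients, where `h₁`
and `h₂` are fixed elements of the cone that are linearly independent over ℝ at every nonreal point
of the open disc (`exists_isConeElement_pair`). They are Schwarz integrals of bumps on two arcs of
the circle exchanged by reflection in the imaginary axis, symmetrized under conjugation. Every such
`h` makes the twisted map an immersion, since multiplication by a scalar function does not change `σ
∘ f`, and a small `h` keeps the boundary norms large.

Avoiding `E`: the map `(z, t) ↦ exp (-h z) • f z` is an immersion at nonreal `z`. Hypothesis (c)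
detects the motion of the line, and independence of `h₁ z`, `h₂ z` detects motion within it. So the
preimage of a curve has Hausdorff dimension at most 1, and its projection to the parameter plane is
null. Real interior points are sent inside the ball, circle points other than `±1` outside it, and
`±1` keep their images under `f`.

Transversality: for fixed `t₁`, the norm of the twisted map is 1 at an interior point exactly where
`levelRatio` equals `t₂`, so by Morse–Sard almost every `t₂` is good. At `±1` a Hopf-type bound `c *
(1 - x ^ 2) ≤ Re h x` makes the outward radial derivative of the norm positive. Fubini combines the
two null sets. -/

/-! ### Hausdorff dimension and the Morse–Sard theorem -/

theorem dimH_le_of_forall_exists_mem_nhdsWithin {X : Type*} [EMetricSpace X]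
    [SecondCountableTopology X] {s : Set X} {r : ℝ≥0∞}
    (h : ∀ x ∈ s, ∃ t ∈ 𝓝[s] x, dimH t ≤ r) : dimH s ≤ r := by
  by_contra! hlt
  obtain ⟨x, hx, hx'⟩ := exists_mem_nhdsWithin_lt_dimH_of_lt_dimH hlt
  obtain ⟨t, ht, htr⟩ := h x hx
  exact (hx' t ht).not_ge htr

/-- Near a point where the strict derivative is injective, a map does not decrease the Hausdorff
dimension. -/
theorem exists_nhds_dimH_le_dimH_image {E F : Type*} [NormedAddCommGroup E] [NormedSpace ℝ E]
    [FiniteDimensional ℝ E] [NormedAddCommGroup F] [NormedSpace ℝ F] {Φ : E → F} {A : E →L[ℝ] F}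
    {x : E} (hA : HasStrictFDerivAt Φ A x) (hinj : Function.Injective A) :
    ∃ u ∈ 𝓝 x, ∀ S ⊆ u, dimH S ≤ dimH (Φ '' S) := by
  obtain ⟨K, hK0, hK⟩ := (LinearMap.injective_iff_antilipschitz A.toLinearMap).1 hinj
  have hK' : ∀ v, ‖v‖ ≤ K * ‖A v‖ := fun v => by
    have := hK.le_mul_dist v 0
    simpa using this
  have hKr : (0 : ℝ) < K := by exact_mod_cast hK0
  have h1 := hA.isLittleO.def (c := 1 / (2 * K)) (by positivity)
  rw [nhds_prod_eq] at h1
  obtain ⟨u, hu, hu1⟩ := mem_prod_self_iff.1 h1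
  have hu2 : ∀ p ∈ u, ∀ q ∈ u, ‖Φ p - Φ q - A (p - q)‖ ≤ 1 / (2 * K) * ‖p - q‖ :=
    fun p hp q hq => hu1 (mk_mem_prod hp hq)
  refine ⟨u, hu, fun S hS => ?_⟩
  have key : AntilipschitzWith (2 * K) (fun p : S => Φ p) := by
    refine AntilipschitzWith.of_le_mul_dist fun p q => ?_
    have h2 := hu2 p (hS p.2) q (hS q.2)
    have h3 := hK' ((p : E) - q)
    have h4 : ‖A ((p : E) - q)‖ ≤ ‖Φ p - Φ q‖ + 1 / (2 * K) * ‖(p : E) - q‖ := by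
      have := norm_sub_le (Φ p - Φ q) (Φ p - Φ q - A ((p : E) - q))
      rw [sub_sub_cancel] at this
      exact this.trans (by gcongr)
    rw [Subtype.dist_eq, dist_eq_norm, dist_eq_norm]
    push_cast
    have h5 : (K : ℝ) * ‖A ((p : E) - q)‖ ≤ K * ‖Φ p - Φ q‖ + 1 / 2 * ‖(p : E) - q‖ := by
      calc (K : ℝ) * ‖A ((p : E) - q)‖
          ≤ K * (‖Φ p - Φ q‖ + 1 / (2 * K) * ‖(p : E) - q‖) := by gcongr
        _ = _ := by field_simp
    linarith
  have h6 := key.le_dimH_image univ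
  have h7 := (isometry_subtype_coe : Isometry (Subtype.val : S → E)).dimH_image univ
  rw [image_univ, Subtype.range_coe] at h7
  rw [h7]
  refine h6.trans (dimH_mono ?_)
  rintro _ ⟨p, -, rfl⟩
  exact mem_image_of_mem _ p.2

theorem holderOnWith_of_norm_sub_le {E F : Type*} [NormedAddCommGroup E] [NormedAddCommGroup F]
    {g : E → F} {s : Set E} {K : ℝ≥0} {n : ℕ}
    (h : ∀ x ∈ s, ∀ y ∈ s, ‖g x - g y‖ ≤ K * ‖x - y‖ ^ n) : HolderOnWith K n g s := by
  intro x hx y hy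
  have h1 := h x hx y hy
  rw [NNReal.coe_natCast, ENNReal.rpow_natCast, edist_dist, edist_dist, dist_eq_norm, dist_eq_norm,
    ← ENNReal.ofReal_pow (norm_nonneg _), ← ENNReal.ofReal_coe_nnreal,
    ← ENNReal.ofReal_mul K.coe_nonneg]
  exact ENNReal.ofReal_le_ofReal h1

/-- Mean value inequality on the points of `B` no farther from `y` than `w`. Iterated, it turns the
vanishing of derivatives at `y` into a Hölder exponent 2 or 3. -/
theorem norm_sub_le_pow_succ_of_norm_fderiv_le {E F : Type*} [NormedAddCommGroup E]
    [NormedSpace ℝ E] [NormedAddCommGroup F] [NormedSpace ℝ F] {g : E → F} {B : Set E}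
    (hB : Convex ℝ B) {K : ℝ} {n : ℕ} {y : E} (hK : 0 ≤ K) (hy : y ∈ B)
    (hd : ∀ w ∈ B, DifferentiableAt ℝ g w)
    (h : ∀ w ∈ B, ‖fderiv ℝ g w‖ ≤ K * ‖w - y‖ ^ n) {w : E} (hw : w ∈ B) :
    ‖g w - g y‖ ≤ K * ‖w - y‖ ^ (n + 1) := by
  have hc : Convex ℝ (B ∩ closedBall y ‖w - y‖) := hB.inter (convex_closedBall _ _)
  have := hc.norm_image_sub_le_of_norm_fderiv_le (f := g) (C := K * ‖w - y‖ ^ n) (x := y) (y := w)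
    (fun p hp => hd p hp.1) (fun p hp => (h p hp.1).trans ?_) ⟨hy, by simp⟩
    ⟨hw, by simp [dist_eq_norm]⟩
  · rw [pow_succ, ← mul_assoc]; exact this
  · have := hp.2
    rw [mem_closedBall, dist_eq_norm] at this
    gcongr

/-- If `z ≠ 0`, then `z` and `i z` span ℂ over ℝ, so a nonzero `L` cannot kill both. This completes
one real coordinate to a local chart. -/
theorem injective_prod_comp_mul_I {L : ℂ →L[ℝ] ℝ} (hL : L ≠ 0) {M : ℂ →L[ℝ] ℝ}
    (hM : ∀ z, M z = L (Complex.I * z)) : Function.Injective (L.prod M) := by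
  rw [injective_iff_map_eq_zero]
  intro z hz
  by_contra hz0
  apply hL
  ext w
  have h1 : L z = 0 := congrArg Prod.fst hz
  have h2 : L (Complex.I * z) = 0 := by rw [← hM]; exact congrArg Prod.snd hz
  have : w = (w / z).re • z + (w / z).im • (Complex.I * z) := by
    conv_lhs => rw [← div_mul_cancel₀ w hz0, ← Complex.re_add_im (w / z)]
    simp only [Complex.real_smul]
    ring
  rw [this, map_add, map_smul, map_smul, h1, h2]
  simp

/-- The Morse–Sard theorem for functions on a plane domain: the set of critical values of a `C³`
function is small. -/
theorem dimH_image_critical_le {g : ℂ → ℝ} {U : Set ℂ} (hU : IsOpen U) (hg : ContDiffOn ℝ 3 g U) :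
    dimH (g '' {x | x ∈ U ∧ fderiv ℝ g x = 0}) ≤ 2 / 3 := by
  set g' := fderiv ℝ g
  set g'' := fderiv ℝ g'
  have hg1 : ContDiffOn ℝ 2 g' U := hg.fderiv_of_isOpen hU (by norm_num)
  have hg2 : ContDiffOn ℝ 1 g'' U := hg1.fderiv_of_isOpen hU (by norm_num)
  have hd0 : ∀ x ∈ U, DifferentiableAt ℝ g x := fun x hx =>
    (hg.contDiffAt (hU.mem_nhds hx)).differentiableAt (by norm_num)
  have hd1 : ∀ x ∈ U, DifferentiableAt ℝ g' x := fun x hx =>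
    (hg1.contDiffAt (hU.mem_nhds hx)).differentiableAt (by norm_num)
  have hlip1 : ∀ x ∈ U, ∃ K : ℝ≥0, ∃ r > 0, ball x r ⊆ U ∧ LipschitzOnWith K g' (ball x r) := by
    intro x hx
    obtain ⟨K, t, ht, hK⟩ :=
      ((hg1.contDiffAt (hU.mem_nhds hx)).of_le (by norm_num)).exists_lipschitzOnWith
    obtain ⟨r, hr, hrt⟩ := Metric.mem_nhds_iff.1 (inter_mem ht (hU.mem_nhds hx))
    exact ⟨K, r, hr, fun y hy => (hrt hy).2, hK.mono fun y hy => (hrt hy).1⟩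
  have hlip2 : ∀ x ∈ U, ∃ K : ℝ≥0, ∃ r > 0, ball x r ⊆ U ∧ LipschitzOnWith K g'' (ball x r) := by
    intro x hx
    obtain ⟨K, t, ht, hK⟩ := (hg2.contDiffAt (hU.mem_nhds hx)).exists_lipschitzOnWith
    obtain ⟨r, hr, hrt⟩ := Metric.mem_nhds_iff.1 (inter_mem ht (hU.mem_nhds hx))
    exact ⟨K, r, hr, fun y hy => (hrt hy).2, hK.mono fun y hy => (hrt hy).1⟩
  -- On `C1` the dimension is at most 1 and `g` is Hölder of exponent 2, which gives 1/2. On `C2`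
  -- the dimension is at most 2 but the exponent is 3, which gives 2/3.
  set C1 := {x | x ∈ U ∧ g' x = 0 ∧ g'' x ≠ 0}
  set C2 := {x | x ∈ U ∧ g' x = 0 ∧ g'' x = 0}
  have hsplit : {x | x ∈ U ∧ g' x = 0} ⊆ C1 ∪ C2 := fun x hx => by
    by_cases h : g'' x = 0
    · exact Or.inr ⟨hx.1, hx.2, h⟩
    · exact Or.inl ⟨hx.1, hx.2, h⟩
  have hC1 : dimH C1 ≤ 1 := by
    refine dimH_le_of_forall_exists_mem_nhdsWithin fun y hy => ?_
    obtain ⟨v, hv⟩ : ∃ v, (g'' y).flip v ≠ 0 := by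
      by_contra! h
      refine hy.2.2 (ContinuousLinearMap.ext fun w => ContinuousLinearMap.ext fun v => ?_)
      simpa using congrArg (fun l => l w) (h v)
    set L := (g'' y).flip v
    let M : ℂ →L[ℝ] ℝ := L.comp (ContinuousLinearMap.mul ℝ ℂ Complex.I)
    -- This local chart sends `C1` into the line `{0} × ℝ`, because `g'` vanishes there.
    have hst : HasStrictFDerivAt (fun x => (g' x v, M x)) (L.prod M) y := by
      refine HasStrictFDerivAt.prodMk ?_ M.hasStrictFDerivAt
      have h1 : HasStrictFDerivAt g' (g'' y) y :=
        (hg1.contDiffAt (hU.mem_nhds hy.1)).hasStrictFDerivAt (by norm_num)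
      exact (ContinuousLinearMap.apply ℝ ℝ v).hasStrictFDerivAt.comp y h1
    obtain ⟨u, hu, hu'⟩ := exists_nhds_dimH_le_dimH_image hst
      (injective_prod_comp_mul_I hv fun z => rfl)
    refine ⟨u ∩ C1, inter_mem (mem_nhdsWithin_of_mem_nhds hu) self_mem_nhdsWithin,
      (hu' _ inter_subset_left).trans ?_⟩
    have hl : LipschitzWith 1 (fun t : ℝ => ((0 : ℝ), t)) := LipschitzWith.prodMk_left 0
    refine (dimH_mono ?_).trans (hl.dimH_range_le.trans Real.dimH_univ.le)
    rintro _ ⟨x, hx, rfl⟩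
    exact ⟨M x, by simp [hx.2.2.1]⟩
  have hC2 : dimH C2 ≤ 2 := by
    refine (dimH_mono (subset_univ _)).trans ?_
    rw [Real.dimH_univ_eq_finrank]
    simp
  have him1 : dimH (g '' C1) ≤ dimH C1 / (2 : ℝ≥0) := by
    refine dimH_image_le_of_locally_holder_on (by norm_num) fun x hx => ?_
    obtain ⟨K, r, hr, hrU, hK⟩ := hlip1 x hx.1
    refine ⟨K, ball x r ∩ C1,
      inter_mem (mem_nhdsWithin_of_mem_nhds (ball_mem_nhds x hr)) self_mem_nhdsWithin, ?_⟩
    refine holderOnWith_of_norm_sub_le (n := 2) fun p hp q hq => ?_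
    refine norm_sub_le_pow_succ_of_norm_fderiv_le (convex_ball x r) K.2 hq.1
      (fun w hw => hd0 w (hrU hw)) (fun w hw => ?_) hp.1
    have := hK.norm_sub_le hw hq.1
    rw [hq.2.2.1, sub_zero] at this
    simpa using this
  have him2 : dimH (g '' C2) ≤ dimH C2 / (3 : ℝ≥0) := by
    refine dimH_image_le_of_locally_holder_on (by norm_num) fun x hx => ?_
    obtain ⟨K, r, hr, hrU, hK⟩ := hlip2 x hx.1
    refine ⟨K, ball x r ∩ C2,
      inter_mem (mem_nhdsWithin_of_mem_nhds (ball_mem_nhds x hr)) self_mem_nhdsWithin, ?_⟩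
    refine holderOnWith_of_norm_sub_le (n := 3) fun p hp q hq => ?_
    refine norm_sub_le_pow_succ_of_norm_fderiv_le (convex_ball x r) K.2 hq.1
      (fun w hw => hd0 w (hrU hw)) (fun w hw => ?_) hp.1
    have h1 := norm_sub_le_pow_succ_of_norm_fderiv_le (g := g') (n := 1) (convex_ball x r) K.2 hq.1
      (fun w hw => hd1 w (hrU hw)) (fun w hw => ?_) hw
    · rw [hq.2.2.1, sub_zero] at h1
      exact h1
    · have := hK.norm_sub_le hw hq.1
      rw [hq.2.2.2, sub_zero] at this
      simpa using this
  calc dimH (g '' {x | x ∈ U ∧ g' x = 0}) ≤ dimH (g '' C1 ∪ g '' C2) := by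
        rw [← image_union]; exact dimH_mono (image_mono hsplit)
    _ = max (dimH (g '' C1)) (dimH (g '' C2)) := dimH_union _ _
    _ ≤ 2 / 3 := by
      refine max_le (him1.trans ?_) (him2.trans ?_)
      · refine (ENNReal.div_le_div_right hC1 _).trans ?_
        rw [← ENNReal.toReal_le_toReal] <;> simp [ENNReal.div_eq_top]
        norm_num
      · exact ENNReal.div_le_div_right hC2 _

theorem volume_image_critical_eq_zero {g : ℂ → ℝ} {U : Set ℂ} (hU : IsOpen U)
    (hg : ContDiffOn ℝ 3 g U) : volume (g '' {x | x ∈ U ∧ fderiv ℝ g x = 0}) = 0 := by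
  rw [← hausdorffMeasure_real]
  have := hausdorffMeasure_of_dimH_lt (d := 1) ((dimH_image_critical_le hU hg).trans_lt ?_)
  · simpa using this
  · rw [← ENNReal.toReal_lt_toReal] <;> simp [ENNReal.div_eq_top]
    norm_num

theorem IsEmbeddedCurve.dimH_le_one {V : Type*} [NormedAddCommGroup V] [NormedSpace ℝ V]
    [SecondCountableTopology V] {E : Set V} (hE : IsEmbeddedCurve E) : dimH E ≤ 1 := by
  refine dimH_le_of_forall_exists_mem_nhdsWithin fun p hp => ?_
  obtain ⟨U, J, γ, hU, hpU, hJ, -, hγ, -, -, him⟩ := hE p hp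
  refine ⟨E ∩ U, inter_mem self_mem_nhdsWithin (mem_nhdsWithin_of_mem_nhds (hU.mem_nhds hpU)), ?_⟩
  have hJc : Convex ℝ J := by
    rcases hJ with rfl | rfl
    · exact convex_Ioo _ _
    · exact convex_Ico _ _
  rw [← him]
  refine ((hγ.of_le (by simp)).dimH_image_le hJc subset_rfl).trans ?_
  exact (dimH_mono (subset_univ _)).trans Real.dimH_univ.le

/-! ### Power series that are smooth up to the boundary -/

theorem norm_pow_sub_pow_sub_le {z w : ℂ} (hz : ‖z‖ ≤ 1) (hw : ‖w‖ ≤ 1) (n : ℕ) :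
    ‖z ^ n - w ^ n - n * w ^ (n - 1) * (z - w)‖ ≤ (n : ℝ) ^ 2 * ‖z - w‖ ^ 2 := by
  induction n with
  | zero => simp
  | succ n ih =>
    have hD : z ^ (n + 1) - w ^ (n + 1) - ((n + 1 : ℕ) : ℂ) * w ^ (n + 1 - 1) * (z - w) =
        z * (z ^ n - w ^ n - n * w ^ (n - 1) * (z - w)) + n * w ^ (n - 1) * (z - w) ^ 2 := by
      rcases n with _ | n
      · simp
      · push_cast [Nat.add_sub_cancel]
        ring
    rw [hD]
    calc _ ≤ ‖z‖ * ‖z ^ n - w ^ n - n * w ^ (n - 1) * (z - w)‖ +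
          n * ‖w‖ ^ (n - 1) * ‖z - w‖ ^ 2 := by
            refine (norm_add_le _ _).trans_eq ?_
            simp [norm_pow]
      _ ≤ 1 * ((n : ℝ) ^ 2 * ‖z - w‖ ^ 2) + n * 1 * ‖z - w‖ ^ 2 := by
            gcongr
            exact pow_le_one₀ (norm_nonneg _) hw
      _ ≤ _ := by
            push_cast
            nlinarith [mul_nonneg (Nat.cast_nonneg (α := ℝ) n) (sq_nonneg ‖z - w‖),
              sq_nonneg ‖z - w‖]

/-- A power series with rapidly decreasing coefficients is smooth on the closed disc. -/
theorem contDiffOn_tsum_mul_pow {a : ℕ → ℂ} (ha : ∀ k : ℕ, Summable fun n : ℕ => (n : ℝ) ^ k * ‖a n‖) :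
    ContDiffOn ℂ ∞ (fun z => ∑' n, a n * z ^ n) cDisc := by
  have hu : UniqueDiffOn ℂ cDisc := uniqueDiffOn_convex_of_isRCLikeNormedField
    (convex_closedBall _ _) (by rw [interior_closedBall _ one_ne_zero]; exact ⟨0, by simp⟩)
  rw [contDiffOn_infty]
  intro m
  induction m generalizing a with
  | zero =>
    rw [Nat.cast_zero, contDiffOn_zero]
    refine continuousOn_tsum (u := fun n => ‖a n‖) (fun n => by fun_prop)
      (by simpa using ha 0) fun n z hz => ?_
    rw [norm_mul, norm_pow]
    exact mul_le_of_le_one_right (norm_nonneg _)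
      (pow_le_one₀ (norm_nonneg _) (by simpa using hz))
  | succ m ih =>
    set b : ℕ → ℂ := fun n => (n + 1) * a (n + 1)
    have hb : ∀ k : ℕ, Summable fun n : ℕ => (n : ℝ) ^ k * ‖b n‖ := fun k => by
      refine Summable.of_nonneg_of_le (fun n => by positivity) (fun n => ?_)
        ((summable_nat_add_iff 1).2 (ha (k + 1)))
      have : ‖b n‖ = ((n : ℝ) + 1) * ‖a (n + 1)‖ := by
        simp only [b, norm_mul]
        congr 1
        exact_mod_cast Complex.norm_natCast (n + 1)
      rw [this, pow_succ, ← mul_assoc]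
      push_cast
      gcongr
      linarith
    have hs0 : ∀ z ∈ cDisc, Summable fun n => a n * z ^ n := fun z hz => by
      refine Summable.of_norm_bounded (by simpa using ha 0) fun n => ?_
      rw [norm_mul, norm_pow]
      exact mul_le_of_le_one_right (norm_nonneg _)
        (pow_le_one₀ (norm_nonneg _) (by simpa using hz))
    have hs1 : ∀ z ∈ cDisc, HasSum (fun n => a n * (n * z ^ (n - 1))) (∑' n, b n * z ^ n) :=
      fun z hz => by
      -- The term of index 0 vanishes, so shifting the index loses nothing.
      rw [← hasSum_nat_add_iff' 1]
      simp only [Finset.range_one, Finset.sum_singleton, Nat.cast_zero, zero_mul, mul_zero,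
        sub_zero, Nat.add_sub_cancel]
      have h1 : Summable fun n => b n * z ^ n := by
        refine Summable.of_norm_bounded (by simpa using hb 0) fun n => ?_
        rw [norm_mul, norm_pow]
        exact mul_le_of_le_one_right (norm_nonneg _)
          (pow_le_one₀ (norm_nonneg _) (by simpa using hz))
      refine h1.hasSum.congr_fun fun n => ?_
      simp only [b]
      push_cast
      ring
    have hd : ∀ w ∈ cDisc,
        HasDerivWithinAt (fun z => ∑' n, a n * z ^ n) (∑' n, b n * w ^ n) cDisc w := by
      intro w hw
      rw [hasDerivWithinAt_iff_isLittleO]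
      -- The quadratic remainders of the monomials are summed, with total constant `∑ n ^ 2 * ‖a
      -- n‖`; this works at boundary points as well.
      refine Asymptotics.IsBigO.trans_isLittleO (g := fun z => ‖z - w‖ ^ 2) ?_
        ((Asymptotics.isLittleO_pow_sub_sub w one_lt_two).mono nhdsWithin_le_nhds)
      refine Asymptotics.IsBigO.of_bound (∑' n : ℕ, (n : ℝ) ^ 2 * ‖a n‖) ?_
      filter_upwards [self_mem_nhdsWithin] with z hz
      have h1 := (((hs0 z hz).hasSum.sub (hs0 w hw).hasSum).sub ((hs1 w hw).mul_left (z - w)))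
      rw [smul_eq_mul, ← h1.tsum_eq, norm_pow, norm_norm]
      refine tsum_of_norm_bounded ((ha 2).hasSum.mul_right _) fun n => ?_
      have h2 := norm_pow_sub_pow_sub_le (z := z) (w := w) (by simpa using hz) (by simpa using hw) n
      calc _ = ‖a n‖ * ‖z ^ n - w ^ n - n * w ^ (n - 1) * (z - w)‖ := by
            rw [← norm_mul]; congr 1; ring
        _ ≤ ‖a n‖ * ((n : ℝ) ^ 2 * ‖z - w‖ ^ 2) := by gcongr
        _ = _ := by ring
    rw [Nat.cast_add, Nat.cast_one, contDiffOn_succ_iff_derivWithin hu]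
    refine ⟨fun w hw => (hd w hw).differentiableWithinAt, by simp, ?_⟩
    exact (ih hb).congr fun w hw => (hd w hw).derivWithin (hu w hw)

/-! ### The symmetrized Schwarz kernel -/

/-- The Schwarz kernel of the disc, symmetrized with respect to conjugation; `c` is the real part
of the boundary point. -/
noncomputable def schwarzKernel (c : ℝ) (z : ℂ) : ℂ := (1 - z ^ 2) / (1 - 2 * c * z + z ^ 2)

theorem one_sub_two_mul_add_sq_eq {c s : ℝ} (h : c ^ 2 + s ^ 2 = 1) (z : ℂ) :
    1 - 2 * c * z + z ^ 2 = (z - (c + s * Complex.I)) * (z - (c - s * Complex.I)) := by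
  have : (c : ℂ) ^ 2 + (s : ℂ) ^ 2 = 1 := by exact_mod_cast h
  linear_combination -this + (s : ℂ) ^ 2 * Complex.I_sq

theorem norm_add_mul_I_sq (c s : ℝ) : ‖(c : ℂ) + s * Complex.I‖ ^ 2 = c ^ 2 + s ^ 2 := by
  rw [Complex.sq_norm, Complex.normSq_add_mul_I]

/-- The roots are `c ± i √(1 - c ^ 2)`, which lie on the unit circle. -/
theorem schwarzKernel_denom_ne_zero {c : ℝ} (hc : |c| ≤ 1) {z : ℂ} (hz : ‖z‖ < 1) :
    1 - 2 * c * z + z ^ 2 ≠ 0 := by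
  have hs : c ^ 2 + Real.sqrt (1 - c ^ 2) ^ 2 = 1 := by
    rw [Real.sq_sqrt (by nlinarith [(abs_le.1 hc).1, (abs_le.1 hc).2])]; ring
  rw [one_sub_two_mul_add_sq_eq hs]
  refine mul_ne_zero ?_ ?_ <;> refine sub_ne_zero.2 fun h => hz.ne ?_
  · rw [h, ← sq_eq_sq₀ (norm_nonneg _) zero_le_one, norm_add_mul_I_sq, hs, one_pow]
  · have := norm_add_mul_I_sq c (-Real.sqrt (1 - c ^ 2))
    rw [neg_sq, hs, Complex.ofReal_neg, neg_mul, ← sub_eq_add_neg] at this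
    rw [h, ← sq_eq_sq₀ (norm_nonneg _) zero_le_one, this, one_pow]

theorem schwarzKernel_re (c : ℝ) (z : ℂ) : (schwarzKernel c z).re =
    (1 - Complex.normSq z) * (1 + Complex.normSq z - 2 * c * z.re) /
      Complex.normSq (1 - 2 * c * z + z ^ 2) := by
  rw [schwarzKernel, Complex.div_re, ← add_div]
  congr 1
  simp [Complex.normSq_apply, pow_two]
  ring

theorem schwarzKernel_re_pos {c : ℝ} (hc : |c| ≤ 1) {z : ℂ} (hz : ‖z‖ < 1) :
    0 < (schwarzKernel c z).re := by
  rw [schwarzKernel_re]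
  have h1 : Complex.normSq z < 1 := by
    rw [← Complex.sq_norm]; exact pow_lt_one₀ (norm_nonneg _) hz two_ne_zero
  have h3 : |c * z.re| ≤ ‖z‖ := by
    rw [abs_mul]
    calc |c| * |z.re| ≤ 1 * ‖z‖ := by gcongr; exact Complex.abs_re_le_norm z
      _ = ‖z‖ := one_mul _
  have h2 : 0 < 1 + Complex.normSq z - 2 * c * z.re := by
    rw [← Complex.sq_norm]
    have := (abs_le.1 h3).2
    nlinarith [sq_nonneg (1 - ‖z‖), mul_pos (sub_pos.2 hz) (sub_pos.2 hz)]
  exact div_pos (mul_pos (by linarith) h2)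
    (Complex.normSq_pos.2 (schwarzKernel_denom_ne_zero hc hz))

/-- The extra factor is the reciprocal of the kernel with `c = 0`. The quotient of the two kernels
has imaginary part of the sign of `c * z.im`, which tells the two sides of the imaginary axis apart.
-/
theorem schwarzKernel_mul_im (c : ℝ) {z : ℂ} (hz : ‖z‖ < 1) :
    (schwarzKernel c z * ((1 + z ^ 2) / (1 - z ^ 2))).im =
      2 * c * z.im * (1 - Complex.normSq z) / Complex.normSq (1 - 2 * c * z + z ^ 2) := by
  have h1 : 1 - z ^ 2 ≠ 0 := fun h => by
    have h2 : ‖z‖ ^ 2 = 1 := by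
      rw [← norm_pow, ← sub_eq_zero.1 h, norm_one]
    exact (pow_lt_one₀ (norm_nonneg _) hz two_ne_zero).ne h2
  rw [schwarzKernel, div_mul_div_comm, mul_comm (1 - z ^ 2), mul_div_mul_right _ _ h1,
    Complex.div_im, ← sub_div]
  congr 1
  simp [Complex.normSq_apply, pow_two]
  ring

/-- At a real point the denominator is positive and at most 4. Integrated against a bump, this
becomes the Hopf bound. -/
theorem schwarzKernel_ofReal_ge {c : ℝ} (hc : |c| ≤ 1) {x : ℝ} (hx : x ∈ Ioo (-1 : ℝ) 1) :
    (1 - x ^ 2) / 4 ≤ (schwarzKernel c x).re := by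
  have hne := schwarzKernel_denom_ne_zero hc (z := x)
    (by rw [Complex.norm_real, Real.norm_eq_abs, abs_lt]; exact hx)
  have h1 : (schwarzKernel c x).re = (1 - x ^ 2) / (1 - 2 * c * x + x ^ 2) := by
    rw [schwarzKernel]
    exact_mod_cast Complex.ofReal_re _
  have h2 : (1 - 2 * c * x + x ^ 2) ≠ 0 := by exact_mod_cast hne
  obtain ⟨hx1, hx2⟩ := hx
  obtain ⟨hc1, hc2⟩ := abs_le.1 hc
  have h3 : 0 < 1 - 2 * c * x + x ^ 2 := by
    refine lt_of_le_of_ne ?_ h2.symm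
    nlinarith [sq_nonneg (c - x), mul_nonneg (sub_nonneg.2 hc2) (by linarith : 0 ≤ 1 + c)]
  rw [h1]
  refine div_le_div_of_nonneg_left (by nlinarith) h3 ?_
  nlinarith [sq_nonneg (c + x), mul_nonneg (sub_nonneg.2 hc2) (by linarith : 0 ≤ 1 + c)]

/-- With `w = exp (i θ)`, the kernel is `(1 - w z)⁻¹ + (1 - w⁻¹ z)⁻¹ - 1`, and both fractions are
geometric series. -/
theorem hasSum_schwarzKernel (θ : ℝ) {z : ℂ} (hz : ‖z‖ < 1) :
    HasSum (fun n : ℕ => (((if n = 0 then 1 else 2) * Real.cos (n * θ) : ℝ) : ℂ) * z ^ n)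
      (schwarzKernel (Real.cos θ) z) := by
  set w := Complex.exp (θ * Complex.I)
  set w' := Complex.exp (-θ * Complex.I)
  have hw : ‖w‖ = 1 := Complex.norm_exp_ofReal_mul_I θ
  have hw' : ‖w'‖ = 1 := by
    have := Complex.norm_exp_ofReal_mul_I (-θ)
    simpa [w'] using this
  have hww : w * w' = 1 := by
    simp only [w, w', ← Complex.exp_add]
    simp
  have hcos : w + w' = 2 * Real.cos θ := by
    rw [Complex.ofReal_cos, Complex.cos]
    simp only [w, w']
    ring
  have h1 := hasSum_geometric_of_norm_lt_one (ξ := w * z) (by rwa [norm_mul, hw, one_mul])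
  have h2 := hasSum_geometric_of_norm_lt_one (ξ := w' * z) (by rwa [norm_mul, hw', one_mul])
  have h3 := (h1.add h2).sub (hasSum_ite_eq (0 : ℕ) (1 : ℂ))
  have e1 : 1 - w * z ≠ 0 := fun h => by
    have : ‖w * z‖ = 1 := by rw [← sub_eq_zero.1 h, norm_one]
    rw [norm_mul, hw, one_mul] at this
    exact hz.ne this
  have e2 : 1 - w' * z ≠ 0 := fun h => by
    have : ‖w' * z‖ = 1 := by rw [← sub_eq_zero.1 h, norm_one]
    rw [norm_mul, hw', one_mul] at this
    exact hz.ne this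
  have e3 : 1 - 2 * (Real.cos θ : ℂ) * z + z ^ 2 = (1 - w * z) * (1 - w' * z) := by
    linear_combination z * hcos - z ^ 2 * hww
  have h4 : (1 - w * z)⁻¹ + (1 - w' * z)⁻¹ - 1 = schwarzKernel (Real.cos θ) z := by
    rw [schwarzKernel, e3, eq_div_iff (mul_ne_zero e1 e2)]
    linear_combination (1 - w' * z) * inv_mul_cancel₀ e1 + (1 - w * z) * inv_mul_cancel₀ e2 -
      z ^ 2 * hww
  rw [← h4]
  refine h3.congr_fun fun n => ?_
  have hn : (w * z) ^ n + (w' * z) ^ n = 2 * Real.cos (n * θ) * z ^ n := by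
    rw [mul_pow, mul_pow, ← add_mul]
    congr 1
    simp only [w, w', ← Complex.exp_nat_mul]
    rw [Complex.ofReal_cos, Complex.cos]
    push_cast
    ring_nf
  rcases eq_or_ne n 0 with rfl | hn0
  · simp
  · rw [hn]; simp [hn0]

/-! ### Arc bumps and their Schwarz integrals -/

/-- A bump function on the upper half of the circle, in the coordinate `x ↦ exp (2 π i x)`, whose
support lies on the side of the imaginary axis given by the sign of `τ`. -/
structure IsArcBump (ψ : ℝ → ℝ) (τ : ℝ) : Prop where
  contDiff : ContDiff ℝ ∞ ψ
  hasCompactSupport : HasCompactSupport ψ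
  nonneg : ∀ x, 0 ≤ ψ x
  exists_ne_zero : ∃ x, ψ x ≠ 0
  half_le_sin : ∀ x, ψ x ≠ 0 → 1 / 2 ≤ Real.sin (2 * Real.pi * x)
  mul_cos_pos : ∀ x, ψ x ≠ 0 → 0 < τ * Real.cos (2 * Real.pi * x)

theorem exists_isArcBump_one : ∃ ψ, IsArcBump ψ 1 := by
  -- The support corresponds to the angles from π/6 to π/3.
  let b : ContDiffBump (1 / 8 : ℝ) := ⟨1 / 48, 1 / 24, by norm_num, by norm_num⟩
  have hb : ∀ x, b x ≠ 0 → Real.pi / 6 < 2 * Real.pi * x ∧ 2 * Real.pi * x < Real.pi / 3 := by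
    intro x hx
    have h1 : x ∈ ball (1 / 8 : ℝ) (1 / 24) := by
      have : x ∈ Function.support b := hx
      rwa [b.support_eq] at this
    rw [Real.ball_eq_Ioo] at h1
    have := Real.pi_pos
    constructor <;> nlinarith [h1.1, h1.2]
  refine ⟨b, b.contDiff, b.hasCompactSupport, fun x => b.nonneg, ⟨1 / 8, ?_⟩, fun x hx => ?_,
    fun x hx => ?_⟩
  · exact (b.pos_of_mem_ball (mem_ball_self b.rOut_pos)).ne'
  · rw [← Real.sin_pi_div_six]
    exact Real.sin_le_sin_of_le_of_le_pi_div_two (by linarith [Real.pi_pos])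
      (by linarith [(hb x hx).2, Real.pi_pos]) (hb x hx).1.le
  · rw [one_mul]
    exact Real.cos_pos_of_mem_Ioo ⟨by linarith [(hb x hx).1, Real.pi_pos],
      by linarith [(hb x hx).2, Real.pi_pos]⟩

/-- The substitution is `θ ↦ π - θ` on angles: the sine is kept and the cosine changes sign. -/
theorem IsArcBump.reflect {ψ : ℝ → ℝ} {τ : ℝ} (h : IsArcBump ψ τ) :
    IsArcBump (fun x => ψ (1 / 2 - x)) (-τ) := by
  have e : ∀ x : ℝ, 2 * Real.pi * (1 / 2 - x) = Real.pi - 2 * Real.pi * x := fun x => by ring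
  refine ⟨h.contDiff.comp (by fun_prop),
    h.hasCompactSupport.comp_homeomorph (Homeomorph.subLeft (1 / 2)), fun x => h.nonneg _, ?_,
    fun x hx => ?_, fun x hx => ?_⟩
  · obtain ⟨x, hx⟩ := h.exists_ne_zero
    exact ⟨1 / 2 - x, by rwa [sub_sub_cancel]⟩
  · have := h.half_le_sin _ hx
    rwa [e, Real.sin_pi_sub] at this
  · have := h.mul_cos_pos _ hx
    rw [e, Real.cos_pi_sub] at this
    linarith

/-- The integral is the real part of the Fourier transform of `ψ` at `n`, and `ψ` is a Schwartz
function. -/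
theorem exists_pow_mul_abs_integral_cos_le {ψ : ℝ → ℝ} (h1 : ContDiff ℝ ∞ ψ)
    (h2 : HasCompactSupport ψ) (k : ℕ) :
    ∃ C : ℝ, ∀ n : ℕ, (n : ℝ) ^ k * |∫ x, ψ x * Real.cos (n * (2 * Real.pi * x))| ≤ C := by
  have h1' : ContDiff ℝ ∞ (fun x => (ψ x : ℂ)) := Complex.ofRealCLM.contDiff.comp h1
  have h2' : HasCompactSupport (fun x => (ψ x : ℂ)) := h2.comp_left (g := Complex.ofReal) rfl
  let φ : 𝓢(ℝ, ℂ) := h2'.toSchwartzMap h1'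
  obtain ⟨C, -, hC⟩ := (𝓕 φ).decay k 0
  refine ⟨C, fun n => le_trans ?_ (hC n)⟩
  rw [norm_iteratedFDeriv_zero, Real.norm_natCast]
  gcongr
  have h3 : (𝓕 φ) (n : ℝ) =
      ∫ v : ℝ, (ψ v : ℂ) * Complex.exp (↑(-2 * Real.pi * v * n) * Complex.I) := by
    rw [SchwartzMap.fourier_coe, Real.fourier_real_eq_integral_exp_smul]
    exact integral_congr_ae (Eventually.of_forall fun v => mul_comm _ _)
  have h4 : Integrable fun v : ℝ =>
      (ψ v : ℂ) * Complex.exp (↑(-2 * Real.pi * v * n) * Complex.I) := by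
    have hcont := h1'.continuous
    exact Continuous.integrable_of_hasCompactSupport (by fun_prop) h2'.mul_right
  have h5 : ((𝓕 φ) (n : ℝ)).re = ∫ x, ψ x * Real.cos (n * (2 * Real.pi * x)) := by
    have h6 := Complex.reCLM.integral_comp_comm h4
    rw [h3]
    refine h6.symm.trans (integral_congr_ae (Eventually.of_forall fun x => ?_))
    simp only [Complex.reCLM_apply, Complex.re_ofReal_mul, Complex.exp_ofReal_mul_I_re]
    rw [← Real.cos_neg]
    ring_nf
  rw [← h5]
  exact Complex.abs_re_le_norm _

/-- The coefficients of the Schwarz integral of a bump function and of its mirror image. -/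
noncomputable def schwarzCoeff (ψ : ℝ → ℝ) (n : ℕ) : ℝ :=
  (if n = 0 then 1 else 2) * ∫ x, ψ x * Real.cos (n * (2 * Real.pi * x))

/-- The holomorphic function on the disc whose real part has boundary values given by `ψ` (and its
mirror image), in the coordinate `x ↦ exp (2 π i x)` and up to a constant factor. -/
noncomputable def schwarzIntegral (ψ : ℝ → ℝ) (z : ℂ) : ℂ := ∑' n, (schwarzCoeff ψ n : ℂ) * z ^ n

theorem summable_pow_mul_schwarzCoeff {ψ : ℝ → ℝ} (h1 : ContDiff ℝ ∞ ψ)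
    (h2 : HasCompactSupport ψ) (k : ℕ) :
    Summable fun n : ℕ => (n : ℝ) ^ k * ‖(schwarzCoeff ψ n : ℂ)‖ := by
  -- Two extra powers of `n` allow comparison with `∑ 1 / n ^ 2`.
  obtain ⟨C, hC⟩ := exists_pow_mul_abs_integral_cos_le h1 h2 (k + 2)
  refine (summable_nat_add_iff 1).1 (Summable.of_nonneg_of_le (fun n => by positivity)
    (fun n => ?_) (((summable_nat_add_iff 1).2
      (Real.summable_one_div_nat_pow.2 one_lt_two)).mul_left (2 * C)))
  have := hC (n + 1)
  rw [mul_one_div, le_div_iff₀ (by positivity), Complex.norm_real, schwarzCoeff, norm_mul,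
    Real.norm_eq_abs, Real.norm_eq_abs, if_neg (by omega), abs_of_pos two_pos]
  rw [pow_add] at this
  linarith

theorem schwarzIntegral_contDiffOn {ψ : ℝ → ℝ} (h1 : ContDiff ℝ ∞ ψ) (h2 : HasCompactSupport ψ) :
    ContDiffOn ℂ ∞ (schwarzIntegral ψ) cDisc :=
  contDiffOn_tsum_mul_pow (summable_pow_mul_schwarzCoeff h1 h2)

theorem schwarzIntegral_isAInfty {ψ : ℝ → ℝ} (h1 : ContDiff ℝ ∞ ψ) (h2 : HasCompactSupport ψ) :
    IsAInfty (schwarzIntegral ψ) := by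
  have h := schwarzIntegral_contDiffOn h1 h2
  exact ⟨h.restrict_scalars ℝ, (h.differentiableOn (by simp)).mono ball_subset_closedBall⟩

theorem schwarzIntegral_conj (ψ : ℝ → ℝ) (z : ℂ) :
    schwarzIntegral ψ (conj z) = conj (schwarzIntegral ψ z) := by
  rw [schwarzIntegral, schwarzIntegral, Complex.conj_tsum]
  simp

theorem continuous_schwarzKernel {z : ℂ} (hz : ‖z‖ < 1) :
    Continuous fun x : ℝ => schwarzKernel (Real.cos (2 * Real.pi * x)) z := by
  unfold schwarzKernel
  refine Continuous.div (by fun_prop) (by fun_prop) fun x => ?_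
  exact schwarzKernel_denom_ne_zero (Real.abs_cos_le_one _) hz

/-- Sum and integral are interchanged; the terms are dominated by `2 * ‖ψ x‖ * ‖z‖ ^ n`. -/
theorem schwarzIntegral_eq_integral {ψ : ℝ → ℝ} (h1 : Continuous ψ) (h2 : HasCompactSupport ψ)
    {z : ℂ} (hz : ‖z‖ < 1) : schwarzIntegral ψ z =
      ∫ x, (ψ x : ℂ) * schwarzKernel (Real.cos (2 * Real.pi * x)) z := by
  let c : ℕ → ℝ := fun n => if n = 0 then 1 else 2
  have hc : ∀ n, ‖c n‖ ≤ 2 := fun n => by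
    simp only [c]; split_ifs <;> norm_num
  have h2' : HasCompactSupport (fun x => (ψ x : ℂ)) := h2.comp_left (g := Complex.ofReal) rfl
  have hint : Integrable ψ := h1.integrable_of_hasCompactSupport h2
  let F : ℕ → ℝ → ℂ := fun n x =>
    (ψ x : ℂ) * (((c n * Real.cos (n * (2 * Real.pi * x)) : ℝ) : ℂ) * z ^ n)
  have hF : ∀ n, Integrable (F n) := fun n =>
    Continuous.integrable_of_hasCompactSupport (by fun_prop) h2'.mul_right
  have hb : ∀ n x, ‖F n x‖ ≤ ‖ψ x‖ * (2 * ‖z‖ ^ n) := fun n x => by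
    simp only [F, norm_mul, norm_pow, Complex.norm_real]
    gcongr
    calc ‖c n‖ * ‖Real.cos (n * (2 * Real.pi * x))‖ ≤ 2 * 1 := by
          gcongr
          · exact hc n
          · exact Real.abs_cos_le_one _
      _ = 2 := mul_one _
  have hs : Summable fun n => ∫ x, ‖F n x‖ := by
    refine Summable.of_nonneg_of_le (fun n => integral_nonneg fun x => norm_nonneg _) (fun n => ?_)
      (((summable_geometric_of_lt_one (norm_nonneg z) hz).mul_left 2).mul_left (∫ x, ‖ψ x‖))
    rw [← integral_mul_const]
    exact integral_mono (hF n).norm (hint.norm.mul_const _) (hb n)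
  have h3 := (hasSum_integral_of_summable_integral_norm hF hs).tsum_eq
  rw [schwarzIntegral]
  calc _ = ∑' n, ∫ x, F n x := by
        congr 1
        ext n
        have : ∀ x, F n x = ((c n * (ψ x * Real.cos (n * (2 * Real.pi * x))) : ℝ) : ℂ) * z ^ n :=
          fun x => by simp only [F]; push_cast; ring
        simp_rw [this]
        rw [integral_mul_const, integral_complex_ofReal, integral_const_mul]
        rfl
    _ = _ := by
        rw [h3]
        congr 1
        ext x
        exact ((hasSum_schwarzKernel (2 * Real.pi * x) hz).mul_left _).tsum_eq

theorem integrable_mul_schwarzKernel {ψ : ℝ → ℝ} (h1 : Continuous ψ) (h2 : HasCompactSupport ψ)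
    {z : ℂ} (hz : ‖z‖ < 1) :
    Integrable fun x => (ψ x : ℂ) * schwarzKernel (Real.cos (2 * Real.pi * x)) z := by
  have h2' : HasCompactSupport (fun x => (ψ x : ℂ)) := h2.comp_left (g := Complex.ofReal) rfl
  have := continuous_schwarzKernel hz
  exact Continuous.integrable_of_hasCompactSupport (by fun_prop) h2'.mul_right

theorem schwarzIntegral_re {ψ : ℝ → ℝ} (h1 : Continuous ψ) (h2 : HasCompactSupport ψ)
    {z : ℂ} (hz : ‖z‖ < 1) : (schwarzIntegral ψ z).re =
      ∫ x, ψ x * (schwarzKernel (Real.cos (2 * Real.pi * x)) z).re := by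
  rw [schwarzIntegral_eq_integral h1 h2 hz, ← Complex.reCLM_apply,
    ← ContinuousLinearMap.integral_comp_comm _ (integrable_mul_schwarzKernel h1 h2 hz)]
  simp

theorem integrable_mul_schwarzKernel_re {ψ : ℝ → ℝ} (h1 : Continuous ψ) (h2 : HasCompactSupport ψ)
    {z : ℂ} (hz : ‖z‖ < 1) :
    Integrable fun x => ψ x * (schwarzKernel (Real.cos (2 * Real.pi * x)) z).re := by
  simpa using (integrable_mul_schwarzKernel h1 h2 hz).re

theorem integral_mul_pos {ψ G : ℝ → ℝ} (h1 : Continuous ψ) (h2 : HasCompactSupport ψ)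
    (h3 : ∀ x, 0 ≤ ψ x) (h4 : ∃ x, ψ x ≠ 0) (hG : Continuous G) (hpos : ∀ x, ψ x ≠ 0 → 0 < G x) :
    0 < ∫ x, ψ x * G x := by
  obtain ⟨x, hx⟩ := h4
  refine Continuous.integral_pos_of_hasCompactSupport_nonneg_nonzero (x := x) (h1.mul hG)
    h2.mul_right (fun y => ?_) (mul_ne_zero hx (hpos x hx).ne')
  rcases eq_or_ne (ψ y) 0 with hy | hy
  · simp [hy]
  · exact mul_nonneg (h3 y) (hpos y hy).le

namespace IsArcBump

variable {ψ : ℝ → ℝ} {τ : ℝ}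

theorem schwarzIntegral_re_pos (h : IsArcBump ψ τ) {z : ℂ} (hz : ‖z‖ < 1) :
    0 < (schwarzIntegral ψ z).re := by
  rw [schwarzIntegral_re h.contDiff.continuous h.hasCompactSupport hz]
  exact integral_mul_pos h.contDiff.continuous h.hasCompactSupport h.nonneg h.exists_ne_zero
    (Complex.continuous_re.comp (continuous_schwarzKernel hz))
    fun x _ => schwarzKernel_re_pos (Real.abs_cos_le_one _) hz

theorem schwarzIntegral_mul_im_pos (h : IsArcBump ψ τ) {z : ℂ} (hz : ‖z‖ < 1) (hz' : z.im ≠ 0) :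
    0 < τ * z.im * (schwarzIntegral ψ z * ((1 + z ^ 2) / (1 - z ^ 2))).im := by
  set q := (1 + z ^ 2) / (1 - z ^ 2)
  have hi := (integrable_mul_schwarzKernel h.contDiff.continuous h.hasCompactSupport hz).mul_const q
  rw [schwarzIntegral_eq_integral h.contDiff.continuous h.hasCompactSupport hz,
    ← integral_mul_const, show (∫ x, (ψ x : ℂ) * schwarzKernel (Real.cos (2 * Real.pi * x)) z * q).im
      = _ from (Complex.imCLM.integral_comp_comm hi).symm, ← integral_const_mul]
  have hcont := continuous_schwarzKernel hz
  refine (integral_mul_pos (G := fun x => τ * z.im *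
    (schwarzKernel (Real.cos (2 * Real.pi * x)) z * q).im) h.contDiff.continuous
    h.hasCompactSupport h.nonneg h.exists_ne_zero (by fun_prop) fun x hx => ?_).trans_eq
      (integral_congr_ae (Eventually.of_forall fun x => ?_))
  rotate_left
  · simp only
    rw [Complex.imCLM_apply, mul_assoc (ψ x : ℂ), Complex.im_ofReal_mul]
    ring
  · have h1 : Complex.normSq z < 1 := by
      rw [← Complex.sq_norm]; exact pow_lt_one₀ (norm_nonneg _) hz two_ne_zero
    have h2 := h.mul_cos_pos x hx
    have h3 := Complex.normSq_pos.2 (schwarzKernel_denom_ne_zero (Real.abs_cos_le_one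
      (2 * Real.pi * x)) hz)
    rw [schwarzKernel_mul_im _ hz]
    have h4 : 0 < z.im ^ 2 := by positivity
    have h5 := mul_pos (mul_pos h2 h4) (sub_pos.2 h1)
    rw [← mul_div_assoc]
    refine div_pos ?_ h3
    linarith

theorem exists_schwarzIntegral_ofReal_ge (h : IsArcBump ψ τ) :
    ∃ c > 0, ∀ x ∈ Ioo (-1 : ℝ) 1, c * (1 - x ^ 2) ≤ (schwarzIntegral ψ x).re := by
  have hc := h.contDiff.continuous
  have hint := hc.integrable_of_hasCompactSupport (μ := volume) h.hasCompactSupport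
  have h1 := integral_mul_pos hc h.hasCompactSupport h.nonneg h.exists_ne_zero
    (G := fun _ => 1 / 4) continuous_const fun x _ => by norm_num
  refine ⟨_, h1, fun x hx => ?_⟩
  have hz : ‖(x : ℂ)‖ < 1 := by rw [Complex.norm_real, Real.norm_eq_abs, abs_lt]; exact hx
  rw [schwarzIntegral_re hc h.hasCompactSupport hz, ← integral_mul_const]
  refine integral_mono ((hint.mul_const _).mul_const _)
    (integrable_mul_schwarzKernel_re hc h.hasCompactSupport hz) fun y => ?_
  have := mul_le_mul_of_nonneg_left
    (schwarzKernel_ofReal_ge (Real.abs_cos_le_one (2 * Real.pi * y)) hx) (h.nonneg y)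
  simp only
  linarith

/-- Along the radius to `z` the poles of the kernel stay away, so its real part is at most a
constant times `1 - r ^ 2`. The limit at `r = 1` is thus squeezed between 0 and 0. -/
theorem schwarzIntegral_re_eq_zero (h : IsArcBump ψ τ) {z : ℂ} (hz : ‖z‖ = 1)
    (hz' : |z.im| ≤ 1 / 4) : (schwarzIntegral ψ z).re = 0 := by
  have hc := h.contDiff.continuous
  have hint := hc.integrable_of_hasCompactSupport (μ := volume) h.hasCompactSupport
  have hnorm : ∀ r ∈ Ioo (0 : ℝ) 1, ‖(r : ℂ) * z‖ = r := fun r hr => by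
    rw [norm_mul, hz, mul_one, Complex.norm_real, Real.norm_of_nonneg hr.1.le]
  have hbound : ∀ r ∈ Ioo (0 : ℝ) 1, (schwarzIntegral ψ (r * z)).re ≤
      (1 - r ^ 2) * (1024 * ∫ x, ψ x) := by
    intro r hr
    have hrz : ‖(r : ℂ) * z‖ < 1 := (hnorm r hr).trans_lt hr.2
    rw [schwarzIntegral_re hc h.hasCompactSupport hrz, ← mul_assoc, ← integral_const_mul]
    refine integral_mono (integrable_mul_schwarzKernel_re hc h.hasCompactSupport hrz)
      (hint.const_mul _) fun x => ?_
    rcases eq_or_ne (ψ x) 0 with hx | hx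
    · simp [hx]
    set c := Real.cos (2 * Real.pi * x)
    set s := Real.sin (2 * Real.pi * x)
    have hs : 1 / 2 ≤ s := h.half_le_sin x hx
    have hcs : c ^ 2 + s ^ 2 = 1 := Real.cos_sq_add_sin_sq _
    have him : |((r : ℂ) * z).im| ≤ 1 / 4 := by
      rw [Complex.im_ofReal_mul, abs_mul, abs_of_pos hr.1]
      nlinarith [hr.1, hr.2, abs_nonneg z.im]
    have hre : |c * ((r : ℂ) * z).re| ≤ 1 := by
      rw [abs_mul]
      calc |c| * |((r : ℂ) * z).re| ≤ 1 * 1 := by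
            gcongr
            · exact Real.abs_cos_le_one _
            · exact (Complex.abs_re_le_norm _).trans hrz.le
        _ = 1 := one_mul _
    obtain ⟨him1, him2⟩ := abs_le.1 him
    -- The poles `c ± i s` have imaginary parts of size at least 1/2 and `r z` at most 1/4, so each
    -- factor has squared modulus at least 1/16.
    have hd : 1 / 256 ≤ Complex.normSq (1 - 2 * c * (r * z) + (r * z) ^ 2) := by
      rw [one_sub_two_mul_add_sq_eq hcs, Complex.normSq_mul, Complex.normSq_apply,
        Complex.normSq_apply]
      have e1 : (1 / 16 : ℝ) ≤ ((r * z - (c + s * Complex.I)).im) ^ 2 := by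
        simp only [Complex.sub_im, Complex.add_im, Complex.ofReal_im, Complex.im_ofReal_mul,
          Complex.I_im, mul_one, zero_add] at him1 him2 ⊢
        nlinarith
      have e2 : (1 / 16 : ℝ) ≤ ((r * z - (c - s * Complex.I)).im) ^ 2 := by
        simp only [Complex.sub_im, Complex.ofReal_im, Complex.im_ofReal_mul,
          Complex.I_im, mul_one, zero_sub] at him1 him2 ⊢
        nlinarith
      calc (1 / 256 : ℝ) = 1 / 16 * (1 / 16) := by norm_num
        _ ≤ _ := by
          rw [sq] at e1 e2
          exact mul_le_mul (e1.trans (le_add_of_nonneg_left (mul_self_nonneg _)))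
            (e2.trans (le_add_of_nonneg_left (mul_self_nonneg _))) (by norm_num)
            (add_nonneg (mul_self_nonneg _) (mul_self_nonneg _))
    -- The remaining factor of the numerator is at most 4, and 1024 = 4 · 256.
    have hK : (schwarzKernel c (r * z)).re ≤ (1 - r ^ 2) * 1024 := by
      rw [schwarzKernel_re, div_le_iff₀ (by linarith), ← Complex.sq_norm, hnorm r hr]
      have hr2 : 0 < 1 - r ^ 2 := by nlinarith [hr.1, hr.2]
      rw [mul_assoc, mul_assoc (1 - r ^ 2)]
      refine mul_le_mul_of_nonneg_left ?_ hr2.le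
      have := (abs_le.1 hre).1
      nlinarith
    have := mul_le_mul_of_nonneg_left hK (h.nonneg x)
    simp only
    linarith
  have hcont : ContinuousWithinAt (schwarzIntegral ψ) cDisc z :=
    (schwarzIntegral_contDiffOn h.contDiff h.hasCompactSupport).continuousOn z (by simp [hz])
  have hlim : Tendsto (fun r : ℝ => (schwarzIntegral ψ (r * z)).re) (𝓝[Ioo 0 1] 1)
      (𝓝 (schwarzIntegral ψ z).re) := by
    refine (Complex.continuous_re.tendsto _).comp (hcont.tendsto.comp ?_)
    refine tendsto_nhdsWithin_iff.2 ⟨?_, ?_⟩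
    · have : ContinuousAt (fun r : ℝ => (r : ℂ) * z) 1 := by fun_prop
      simpa using this.tendsto.mono_left nhdsWithin_le_nhds
    · filter_upwards [self_mem_nhdsWithin] with r hr
      rw [mem_closedBall_zero_iff, hnorm r hr]
      exact hr.2.le
  have hlim2 : Tendsto (fun r : ℝ => (1 - r ^ 2) * (1024 * ∫ x, ψ x)) (𝓝[Ioo 0 1] 1) (𝓝 0) := by
    have : ContinuousAt (fun r : ℝ => (1 - r ^ 2) * (1024 * ∫ x, ψ x)) 1 := by fun_prop
    simpa using this.tendsto.mono_left nhdsWithin_le_nhds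
  have hne : (𝓝[Ioo (0 : ℝ) 1] 1).NeBot := by
    rw [nhdsWithin_Ioo_eq_nhdsLT zero_lt_one]; infer_instance
  refine le_antisymm (le_of_tendsto_of_tendsto hlim hlim2 ?_) (ge_of_tendsto hlim ?_)
  · filter_upwards [self_mem_nhdsWithin] with r hr using hbound r hr
  · filter_upwards [self_mem_nhdsWithin] with r hr
    exact (h.schwarzIntegral_re_pos ((hnorm r hr).trans_lt hr.2)).le

end IsArcBump

/-! ### Cone elements and an independent pair -/

/-- Functions in the cone `ℋ⁺_*` that vanish on the circle near `±1` in a uniform way, with the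
lower bound near `±1` given by the Hopf lemma. -/
structure IsConeElement (h : ℂ → ℂ) : Prop where
  isAInfty : IsAInfty h
  map_conj : ∀ z, h (conj z) = conj (h z)
  re_pos : ∀ z, ‖z‖ < 1 → 0 < (h z).re
  re_eq_zero : ∀ z, ‖z‖ = 1 → |z.im| ≤ 1 / 4 → (h z).re = 0
  hopf : ∃ c > 0, ∀ x ∈ Ioo (-1 : ℝ) 1, c * (1 - x ^ 2) ≤ (h x).re

theorem IsArcBump.isConeElement {ψ : ℝ → ℝ} {τ : ℝ} (h : IsArcBump ψ τ) :
    IsConeElement (schwarzIntegral ψ) where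
  isAInfty := schwarzIntegral_isAInfty h.contDiff h.hasCompactSupport
  map_conj := schwarzIntegral_conj ψ
  re_pos _ := h.schwarzIntegral_re_pos
  re_eq_zero _ := h.schwarzIntegral_re_eq_zero
  hopf := h.exists_schwarzIntegral_ofReal_ge

/-- There are two elements of the cone that are linearly independent over `ℝ` at all nonreal points
of the disc. -/
theorem exists_isConeElement_pair : ∃ h₁ h₂ : ℂ → ℂ, IsConeElement h₁ ∧ IsConeElement h₂ ∧
    ∀ z, ‖z‖ < 1 → z.im ≠ 0 → ∀ a b : ℝ, a * h₁ z + b * h₂ z = 0 → a = 0 ∧ b = 0 := by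
  obtain ⟨ψ, hψ⟩ := exists_isArcBump_one
  refine ⟨_, _, hψ.isConeElement, hψ.reflect.isConeElement, fun z hz hz' a b hab => ?_⟩
  have p1 := hψ.schwarzIntegral_re_pos hz
  have p2 := hψ.reflect.schwarzIntegral_re_pos hz
  have q1 := hψ.schwarzIntegral_mul_im_pos hz hz'
  have q2 := hψ.reflect.schwarzIntegral_mul_im_pos hz hz'
  set u := schwarzIntegral ψ z
  set v := schwarzIntegral (fun x => ψ (1 / 2 - x)) z
  set q := (1 + z ^ 2) / (1 - z ^ 2)
  have e1 : a * u.re + b * v.re = 0 := by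
    have := congrArg Complex.re hab
    simpa using this
  have e2 : a * (u * q).im + b * (v * q).im = 0 := by
    have : (a : ℂ) * (u * q) + b * (v * q) = 0 := by linear_combination q * hab
    have := congrArg Complex.im this
    rwa [Complex.add_im, Complex.im_ofReal_mul, Complex.im_ofReal_mul, Complex.zero_im] at this
  set A := z.im * (u * q).im with hA
  set B := z.im * (v * q).im with hB
  have e3 : a * A + b * B = 0 := by
    rw [hA, hB]
    linear_combination z.im * e2
  have hA0 : 0 < A := by linarith
  have hB0 : B < 0 := by linarith
  -- The real parts of `u` and `v` have equal signs while `A` and `B` have opposite ones, so the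
  -- linear system for `a`, `b` is nonsingular.
  have hdet : 0 < A * v.re - B * u.re := by nlinarith
  constructor
  · have : a * (A * v.re - B * u.re) = 0 := by linear_combination v.re * e3 - B * e1
    exact (mul_eq_zero.1 this).resolve_right hdet.ne'
  · have : b * (A * v.re - B * u.re) = 0 := by linear_combination A * e1 - u.re * e3
    exact (mul_eq_zero.1 this).resolve_right hdet.ne'

/-! ### Immersions and avoidance of the curve -/

theorem uniqueDiffOn_cDisc : UniqueDiffOn ℝ cDisc := uniqueDiffOn_convex (convex_closedBall _ _)
  (by rw [interior_closedBall _ one_ne_zero]; exact ⟨0, by simp⟩)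

theorem cDisc_mem_nhds {z : ℂ} (hz : ‖z‖ < 1) : cDisc ∈ 𝓝 z :=
  mem_of_superset (isOpen_ball.mem_nhds (by simpa using hz)) ball_subset_closedBall

theorem mem_cDisc_of_norm_lt {z : ℂ} (hz : ‖z‖ < 1) : z ∈ cDisc := by
  simpa using hz.le

/-- The coordinates of `ℂ²` as real linear maps. -/
noncomputable def coordCLM (i : Fin 2) : C2 →L[ℝ] ℂ :=
  (EuclideanSpace.proj i : C2 →L[ℂ] ℂ).restrictScalars ℝ

@[simp]
theorem coordCLM_apply (i : Fin 2) (w : C2) : coordCLM i w = w i := rfl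

theorem hasFDerivAt_coord (i : Fin 2) (w : C2) :
    HasFDerivAt (fun w : C2 => w i) (coordCLM i) w :=
  (coordCLM i).hasFDerivAt

/-- A vector killed by the differential of a map into `ℂ²` is killed by the differential of the
quotient of the components. -/
theorem hasFDerivWithinAt_quotient_eq_zero {X : Type*} [NormedAddCommGroup X] [NormedSpace ℝ X]
    {F : X → C2} {G : X → ℂ} {s : Set X} {x : X} {F' : X →L[ℝ] C2} {G' : X →L[ℝ] ℂ} {i j : Fin 2}
    (hF : HasFDerivWithinAt F F' s x) (hG : HasFDerivWithinAt G G' s x)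
    (hs : UniqueDiffWithinAt ℝ s x) (hxs : x ∈ s)
    (h : ∀ᶠ y in 𝓝[s] x, G y * F y i = F y j) (hx : F x i ≠ 0) {v : X} (hv : F' v = 0) :
    G' v = 0 := by
  have h1 := (hasFDerivAt_coord i (F x)).comp_hasFDerivWithinAt x hF
  have h2 := (hasFDerivAt_coord j (F x)).comp_hasFDerivWithinAt x hF
  have h3 := hG.mul h1
  have h4 := hs.eq (h3.congr_of_eventuallyEq (h.mono fun y hy => hy.symm)
    (h.self_of_nhdsWithin hxs).symm) h2
  have h5 := congrArg (fun l => l v) h4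
  simpa [hv, hx] using h5

theorem exists_apply_ne_zero {w : C2} (hw : w ≠ 0) : ∃ i, w i ≠ 0 := by
  by_contra! h
  exact hw (by ext i; simpa using h i)

theorem norm_twist (h : ℂ → ℂ) (f : ℂ → C2) (z : ℂ) :
    ‖twist h f z‖ = Real.exp (-(h z).re) * ‖f z‖ := by
  rw [twist, norm_smul, Complex.norm_exp, Complex.neg_re]

theorem twist_ne_zero (h : ℂ → ℂ) {f : ℂ → C2} {z : ℂ} (hf : f z ≠ 0) : twist h f z ≠ 0 :=
  smul_ne_zero (Complex.exp_ne_zero _) hf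

/-- The affine coordinate of the class of `f` is a quotient of the components of any multiple. -/
theorem eventually_affineCoord_mul_eq {f : ℂ → C2} {z : ℂ} {i : Fin 2}
    (hf0 : ∀ z ∈ cDisc, f z ≠ 0) (hi : ∀ᶠ z' in 𝓝[cDisc] z, (sigma ∘ f) z' ∈ affineDom i) :
    ∀ᶠ z' in 𝓝[cDisc] z, ∀ c : ℂ, affineCoord i ((sigma ∘ f) z') * (c * f z' i) =
      c * f z' (1 - i) := by
  filter_upwards [hi, self_mem_nhdsWithin] with z' h1 h2 c
  have h3 := (sigma_mem_affineDom (hf0 z' h2) i).1 h1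
  rw [Function.comp_apply, affineCoord_sigma (hf0 z' h2)]
  field_simp

theorem contDiffOn_twist {h : ℂ → ℂ} {f : ℂ → C2} (hf : ContDiffOn ℝ ∞ f cDisc)
    (hh : ContDiffOn ℝ ∞ h cDisc) : ContDiffOn ℝ ∞ (twist h f) cDisc :=
  (Complex.contDiff_exp.comp_contDiffOn hh.neg).smul hf

theorem isImmersionC2_twist {h : ℂ → ℂ} {f : ℂ → C2} (hf : ContDiffOn ℝ ∞ f cDisc)
    (hf0 : ∀ z ∈ cDisc, f z ≠ 0) (hc : IsImmersionP1 (sigma ∘ f))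
    (hh : ContDiffOn ℝ ∞ h cDisc) : IsImmersionC2 (twist h f) := by
  have hF := contDiffOn_twist hf hh
  refine ⟨hF, fun z hz => (injective_iff_map_eq_zero _).2 fun v hv => ?_⟩
  obtain ⟨i, hi⟩ := exists_apply_ne_zero (hf0 z hz)
  obtain ⟨hi1, hi2, hi3⟩ := hc z hz i ((sigma_mem_affineDom (hf0 z hz) i).2 hi)
  refine (injective_iff_map_eq_zero _).1 hi3 v ?_
  refine hasFDerivWithinAt_quotient_eq_zero (i := i) (j := 1 - i)
    ((hF.differentiableOn (by simp)) z hz).hasFDerivWithinAt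
    (hi2.differentiableWithinAt (by simp)).hasFDerivWithinAt (uniqueDiffOn_cDisc z hz) hz ?_ ?_ hv
  · exact (eventually_affineCoord_mul_eq hf0 hi1).mono fun z' h' => h' _
  · exact mul_ne_zero (Complex.exp_ne_zero _) hi

/-- The parameters for which the twisted disc meets a curve at a nonreal interior point form a null
set. -/
theorem volume_setOf_twist_mem_eq_zero {f : ℂ → C2} (hf : ContDiffOn ℝ ∞ f cDisc)
    (hf0 : ∀ z ∈ cDisc, f z ≠ 0) (hc : IsImmersionP1 (sigma ∘ f)) {E : Set C2}
    (hE : IsEmbeddedCurve E) {h₁ h₂ : ℂ → ℂ} (hh₁ : ContDiffOn ℝ ∞ h₁ cDisc)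
    (hh₂ : ContDiffOn ℝ ∞ h₂ cDisc)
    (hind : ∀ z, ‖z‖ < 1 → z.im ≠ 0 → ∀ a b : ℝ, a * h₁ z + b * h₂ z = 0 → a = 0 ∧ b = 0) :
    volume {p : ℝ × ℝ | ∃ z, ‖z‖ < 1 ∧ z.im ≠ 0 ∧
      twist (fun z => p.1 * h₁ z + p.2 * h₂ z) f z ∈ E} = 0 := by
  set S := {p : ℝ × ℝ | ∃ z, ‖z‖ < 1 ∧ z.im ≠ 0 ∧
      twist (fun z => p.1 * h₁ z + p.2 * h₂ z) f z ∈ E}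
  let Ψ : ℂ × (ℝ × ℝ) → C2 := fun q =>
    Complex.exp (-(q.2.1 * h₁ q.1 + q.2.2 * h₂ q.1)) • f q.1
  let T : Set (ℂ × (ℝ × ℝ)) := {q | ‖q.1‖ < 1 ∧ q.1.im ≠ 0 ∧ Ψ q ∈ E}
  have hST : S = Prod.snd '' T := by
    ext p
    constructor
    · rintro ⟨z, h1, h2, h3⟩
      exact ⟨(z, p), ⟨h1, h2, h3⟩, rfl⟩
    · rintro ⟨⟨z, p⟩, ⟨h1, h2, h3⟩, rfl⟩
      exact ⟨z, h1, h2, h3⟩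
  have hinj : ∀ q ∈ T, HasStrictFDerivAt Ψ (fderiv ℝ Ψ q) q ∧
      Function.Injective (fderiv ℝ Ψ q) := by
    rintro ⟨z, p⟩ ⟨hz, hz', -⟩
    have hzD := mem_cDisc_of_norm_lt hz
    have c1 : ContDiffAt ℝ ∞ (fun q : ℂ × (ℝ × ℝ) => h₁ q.1) (z, p) :=
      (hh₁.contDiffAt (cDisc_mem_nhds hz)).comp (z, p) contDiffAt_fst
    have c2 : ContDiffAt ℝ ∞ (fun q : ℂ × (ℝ × ℝ) => h₂ q.1) (z, p) :=
      (hh₂.contDiffAt (cDisc_mem_nhds hz)).comp (z, p) contDiffAt_fst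
    have c3 : ContDiffAt ℝ ∞ (fun q : ℂ × (ℝ × ℝ) => f q.1) (z, p) :=
      (hf.contDiffAt (cDisc_mem_nhds hz)).comp (z, p) contDiffAt_fst
    have c4 : ContDiff ℝ ∞ (fun q : ℂ × (ℝ × ℝ) => (q.2.1 : ℂ)) :=
      Complex.ofRealCLM.contDiff.comp (by fun_prop)
    have c5 : ContDiff ℝ ∞ (fun q : ℂ × (ℝ × ℝ) => (q.2.2 : ℂ)) :=
      Complex.ofRealCLM.contDiff.comp (by fun_prop)
    have hΨ : ContDiffAt ℝ ∞ Ψ (z, p) :=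
      (((c4.contDiffAt.mul c1).add (c5.contDiffAt.mul c2)).neg.cexp).smul c3
    have hst : HasStrictFDerivAt Ψ (fderiv ℝ Ψ (z, p)) (z, p) := hΨ.hasStrictFDerivAt (by simp)
    refine ⟨hst, (injective_iff_map_eq_zero _).2 ?_⟩
    rintro ⟨ζ, τ⟩ hv
    obtain ⟨i, hi⟩ := exists_apply_ne_zero (hf0 z hzD)
    obtain ⟨hi1, hi2, hi3⟩ := hc z hzD i ((sigma_mem_affineDom (hf0 z hzD) i).2 hi)
    -- The affine coordinate of the line through `Ψ` depends on `z` alone and is immersive there.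
    have hζ : ζ = 0 := by
      refine (injective_iff_map_eq_zero _).1 hi3 ζ ?_
      have hQ := (hi2.differentiableWithinAt (by simp)).hasFDerivWithinAt.hasFDerivAt
        (cDisc_mem_nhds hz)
      have hQ' := HasFDerivAt.comp (z, p) (f := Prod.fst) hQ hasFDerivAt_fst
      refine hasFDerivWithinAt_quotient_eq_zero (s := univ) (i := i) (j := 1 - i)
        hst.hasFDerivAt.hasFDerivWithinAt hQ'.hasFDerivWithinAt uniqueDiffWithinAt_univ
        (mem_univ _) ?_ (mul_ne_zero (Complex.exp_ne_zero _) hi) hv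
      rw [nhdsWithin_univ]
      have h1 := eventually_affineCoord_mul_eq hf0 hi1
      rw [nhdsWithin_eq_nhds.2 (cDisc_mem_nhds hz)] at h1
      exact ((continuous_fst.tendsto (z, p)).eventually h1).mono fun q hq => hq _
    subst hζ
    -- In a pure parameter direction `Ψ` is multiplied by an exponential, with derivative `-k • Ψ`;
    -- this vanishes only if `k = 0`, and independence applies.
    have hline : HasDerivAt (fun r : ℝ => (z, p) + r • ((0 : ℂ), τ)) ((0 : ℂ), τ) 0 := by
      simpa using ((hasDerivAt_id (0 : ℝ)).smul_const ((0 : ℂ), τ)).const_add (z, p)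
    have hd1 : HasDerivAt (fun r : ℝ => Ψ ((z, p) + r • ((0 : ℂ), τ))) 0 0 := by
      have hst' : HasFDerivAt Ψ (fderiv ℝ Ψ (z, p)) ((z, p) + (0 : ℝ) • ((0 : ℂ), τ)) := by
        simpa using hst.hasFDerivAt
      have := hst'.comp_hasDerivAt 0 hline
      rwa [hv] at this
    set k := τ.1 * h₁ z + τ.2 * h₂ z
    have hd2 : HasDerivAt (fun r : ℝ => Ψ ((z, p) + r • ((0 : ℂ), τ)))
        ((-k) • Ψ (z, p)) 0 := by
      have e : (fun r : ℝ => Ψ ((z, p) + r • ((0 : ℂ), τ))) =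
          fun r : ℝ => Complex.exp (r * (-k)) • Ψ (z, p) := by
        funext r
        simp only [Ψ, smul_smul, ← Complex.exp_add]
        simp only [Prod.mk_add_mk, Prod.smul_mk, smul_zero, add_zero, Prod.fst_add, Prod.smul_fst,
          smul_eq_mul, Prod.snd_add, Prod.smul_snd, k]
        congr 2
        push_cast
        ring
      rw [e]
      have h1 : HasDerivAt (fun r : ℝ => Complex.exp (r * (-k))) (-k) 0 := by
        have h2 : HasDerivAt (fun w : ℂ => Complex.exp (w * (-k))) (-k) ((0 : ℝ) : ℂ) := by
          simpa using ((hasDerivAt_id (0 : ℂ)).mul_const (-k)).cexp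
        exact h2.comp_ofReal
      exact h1.smul_const _
    have hk : k = 0 := by
      have := hd1.unique hd2
      rcases smul_eq_zero.1 this.symm with h | h
      · exact neg_eq_zero.1 h
      · exact absurd h (smul_ne_zero (Complex.exp_ne_zero _) (hf0 z hzD))
    obtain ⟨ha, hb⟩ := hind z hz hz' _ _ hk
    exact Prod.ext rfl (Prod.ext ha hb)
  -- Locally `Ψ` maps `T` into `E` without lowering the dimension.
  have hT : dimH T ≤ 1 := by
    refine dimH_le_of_forall_exists_mem_nhdsWithin fun q hq => ?_
    obtain ⟨u, hu, hu'⟩ := exists_nhds_dimH_le_dimH_image (hinj q hq).1 (hinj q hq).2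
    refine ⟨u ∩ T, inter_mem (mem_nhdsWithin_of_mem_nhds hu) self_mem_nhdsWithin,
      (hu' _ inter_subset_left).trans ((dimH_mono ?_).trans hE.dimH_le_one)⟩
    rintro _ ⟨x, hx, rfl⟩
    exact hx.2.2.2
  have hS : dimH S ≤ 1 := by
    rw [hST]
    exact (LipschitzWith.prod_snd.dimH_image_le T).trans hT
  rw [← hausdorffMeasure_prod_real]
  have := hausdorffMeasure_of_dimH_lt (d := 2) (hS.trans_lt (by norm_num))
  simpa using this

/-! ### Transversality to the sphere -/

theorem norm_sq_eq_add (w : C2) : ‖w‖ ^ 2 = ‖w 0‖ ^ 2 + ‖w 1‖ ^ 2 := by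
  rw [EuclideanSpace.norm_sq_eq, Fin.sum_univ_two]

theorem contDiff_norm_sq_C2 : ContDiff ℝ ∞ (fun w : C2 => ‖w‖ ^ 2) := by
  simp_rw [norm_sq_eq_add]
  have h : ∀ i, ContDiff ℝ ∞ (fun w : C2 => w i) := fun i =>
    (coordCLM i).contDiff
  exact ((h 0).norm_sq ℝ).add ((h 1).norm_sq ℝ)

theorem fderiv_norm_sq_C2 (w v : C2) :
    fderiv ℝ (fun w : C2 => ‖w‖ ^ 2) w v = 2 * (inner ℂ w v).re := by
  have h := (hasFDerivAt_coord 0 w).norm_sq.add (hasFDerivAt_coord 1 w).norm_sq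
  rw [show (fun w : C2 => ‖w‖ ^ 2) = fun w => ‖w 0‖ ^ 2 + ‖w 1‖ ^ 2 from funext norm_sq_eq_add]
  refine (congrArg (fun l => l v) h.fderiv).trans ?_
  simp [PiLp.inner_apply, Fin.sum_univ_two, Complex.inner]
  ring

theorem hasFDerivAt_norm_sq_C2 (w : C2) :
    HasFDerivAt (fun w : C2 => ‖w‖ ^ 2) (fderiv ℝ (fun w : C2 => ‖w‖ ^ 2) w) w :=
  ((contDiff_norm_sq_C2.differentiable (by simp)) w).hasFDerivAt

/-- The tangent space is a real hyperplane, so one image vector outside it suffices. -/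
theorem exists_apply_add_tangent_eq {p : C2} {D : ℂ →L[ℝ] C2} {a : ℂ}
    (ha : (inner ℂ p (D a)).re ≠ 0) (w : C2) : ∃ a : ℂ, ∃ v ∈ tangentS3 p, D a + v = w := by
  set t : ℝ := (inner ℂ p w).re / (inner ℂ p (D a)).re
  refine ⟨t • a, w - D (t • a), ?_, add_sub_cancel _ _⟩
  have h1 : inner ℂ p (D (t • a)) = (t : ℂ) * inner ℂ p (D a) := by
    rw [map_smul, ← inner_smul_right]; rfl
  simp only [tangentS3, mem_ofPred_eq, inner_sub_right, h1, Complex.sub_re, Complex.re_ofReal_mul]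
  simp only [t]
  field_simp
  ring

theorem exists_mem_Ioo_notMem_of_volume_eq_zero {N : Set ℝ} (hN : volume N = 0) {δ : ℝ}
    (hδ : 0 < δ) : ∃ t ∈ Ioo 0 δ, t ∉ N := by
  by_contra! h
  have := measure_mono_null (show Ioo 0 δ ⊆ N from h) hN
  rw [Real.volume_Ioo, sub_zero, ENNReal.ofReal_eq_zero] at this
  linarith

/-- The function whose critical values are the parameters to be avoided for transversality. -/
noncomputable def levelRatio (f : ℂ → C2) (h₁ h₂ : ℂ → ℂ) (t₁ : ℝ) (z : ℂ) : ℝ :=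
  (Real.log (‖f z‖ ^ 2) / 2 - t₁ * (h₁ z).re) / (h₂ z).re

theorem contDiffOn_levelRatio {f : ℂ → C2} (hf : ContDiffOn ℝ ∞ f cDisc)
    (hf0 : ∀ z ∈ cDisc, f z ≠ 0) {h₁ h₂ : ℂ → ℂ} (hh₁ : ContDiffOn ℝ ∞ h₁ cDisc)
    (hh₂ : ContDiffOn ℝ ∞ h₂ cDisc) (hpos : ∀ z, ‖z‖ < 1 → 0 < (h₂ z).re) (t₁ : ℝ) :
    ContDiffOn ℝ ∞ (levelRatio f h₁ h₂ t₁) (ball 0 1) := by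
  have hb : ball (0 : ℂ) 1 ⊆ cDisc := ball_subset_closedBall
  have e1 := Complex.reCLM.contDiff.comp_contDiffOn (hh₁.mono hb)
  have e2 := Complex.reCLM.contDiff.comp_contDiffOn (hh₂.mono hb)
  have e3 := (contDiff_norm_sq_C2.comp_contDiffOn (hf.mono hb)).log
    fun z hz => pow_ne_zero 2 (norm_ne_zero_iff.2 (hf0 z (hb hz)))
  exact ((e3.div_const 2).sub (contDiffOn_const.mul e1)).div e2
    fun z hz => (hpos z (by simpa using hz)).ne'

/-- For the twisted map `F`, `levelRatio` equals `t₂ + log (‖F‖ ^ 2) / (2 Re h₂)`. Where `‖F‖ = 1`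
its value is `t₂`, and if the differential of `‖F‖ ^ 2` vanishes there, so does that of
`levelRatio`. -/
theorem exists_inner_ne_zero_of_notMem_criticalValues {f : ℂ → C2} (hf : ContDiffOn ℝ ∞ f cDisc)
    (hf0 : ∀ z ∈ cDisc, f z ≠ 0) {h₁ h₂ : ℂ → ℂ} (hh₁ : ContDiffOn ℝ ∞ h₁ cDisc)
    (hh₂ : ContDiffOn ℝ ∞ h₂ cDisc) (hpos : ∀ z, ‖z‖ < 1 → 0 < (h₂ z).re) {t₁ t₂ : ℝ}
    (ht : t₂ ∉ levelRatio f h₁ h₂ t₁ ''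
      {z | z ∈ ball (0 : ℂ) 1 ∧ fderiv ℝ (levelRatio f h₁ h₂ t₁) z = 0}) {z : ℂ} (hz : ‖z‖ < 1)
    (hS : ‖twist (fun z => t₁ * h₁ z + t₂ * h₂ z) f z‖ = 1) :
    ∃ a : ℂ, (inner ℂ (twist (fun z => t₁ * h₁ z + t₂ * h₂ z) f z)
      (fderivWithin ℝ (twist (fun z => t₁ * h₁ z + t₂ * h₂ z) f) cDisc z a)).re ≠ 0 := by
  set F := twist (fun z => t₁ * h₁ z + t₂ * h₂ z) f
  by_contra! hcrit
  have hF : ContDiffOn ℝ ∞ F cDisc :=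
    contDiffOn_twist hf ((contDiffOn_const.mul hh₁).add (contDiffOn_const.mul hh₂))
  have hFz := (((hF.differentiableOn (by simp)) z (mem_cDisc_of_norm_lt hz)).hasFDerivWithinAt
    ).hasFDerivAt (cDisc_mem_nhds hz)
  have hN : HasFDerivAt (fun z => ‖F z‖ ^ 2) (0 : ℂ →L[ℝ] ℝ) z := by
    have := (hasFDerivAt_norm_sq_C2 (F z)).comp z hFz
    refine this.congr_fderiv (ContinuousLinearMap.ext fun a => ?_)
    rw [ContinuousLinearMap.comp_apply, fderiv_norm_sq_C2, hcrit a, mul_zero]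
    rfl
  have hg : ∀ z, ‖z‖ < 1 → levelRatio f h₁ h₂ t₁ z =
      t₂ + Real.log (‖F z‖ ^ 2) * (2 * (h₂ z).re)⁻¹ := by
    intro z hz
    have h0 := (hpos z hz).ne'
    have e1 : ‖F z‖ ^ 2 =
        Real.exp (-2 * (t₁ * (h₁ z).re + t₂ * (h₂ z).re)) * ‖f z‖ ^ 2 := by
      simp only [F, norm_twist]
      rw [mul_pow, ← Real.exp_nat_mul]
      congr 2
      simp
      ring
    rw [e1, Real.log_mul (Real.exp_ne_zero _)
      (pow_ne_zero 2 (norm_ne_zero_iff.2 (hf0 z (mem_cDisc_of_norm_lt hz)))), Real.log_exp,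
      levelRatio]
    field_simp
    ring
  refine ht ⟨z, ⟨by simpa using hz, ?_⟩, ?_⟩
  · have h1 : HasFDerivAt (fun z => Real.log (‖F z‖ ^ 2)) (0 : ℂ →L[ℝ] ℝ) z := by
      simpa using hN.log (by rw [hS]; norm_num)
    have h2 : DifferentiableAt ℝ (fun z => (2 * (h₂ z).re)⁻¹) z := by
      have h3 : DifferentiableAt ℝ h₂ z :=
        (hh₂.contDiffAt (cDisc_mem_nhds hz)).differentiableAt (by simp)
      have h4 : DifferentiableAt ℝ (fun z => (h₂ z).re) z :=
        Complex.reCLM.differentiableAt.comp z h3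
      exact (h4.const_mul 2).inv (mul_ne_zero two_ne_zero (hpos z hz).ne')
    have h5 := (h1.mul h2.hasFDerivAt).const_add t₂
    have h6 : levelRatio f h₁ h₂ t₁ =ᶠ[𝓝 z]
        fun z => t₂ + Real.log (‖F z‖ ^ 2) * (2 * (h₂ z).re)⁻¹ := by
      filter_upwards [isOpen_ball.mem_nhds (show z ∈ ball (0 : ℂ) 1 by simpa using hz)] with y hy
      exact hg y (by simpa using hy)
    rw [(h5.congr_of_eventuallyEq h6).fderiv, hS]
    simp
  · rw [hg z hz, hS]
    simp

/-- Transversality at the points `±1`, by the Hopf lemma. -/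
theorem inner_fderivWithin_pos_of_norm_le {F : ℂ → C2} {s : ℝ} (hs : s = 1 ∨ s = -1)
    (hF : DifferentiableWithinAt ℝ F cDisc s) (hS : ‖F s‖ = 1) {c : ℝ} (hc : 0 < c)
    (hle : ∀ x ∈ Ioo (-1 : ℝ) 1, ‖F x‖ ≤ Real.exp (-(c * (1 - x ^ 2)))) :
    0 < (inner ℂ (F s) (fderivWithin ℝ F cDisc s s)).re := by
  have hs2 : s ^ 2 = 1 := by rcases hs with rfl | rfl <;> norm_num
  have hγ : HasDerivWithinAt (fun r : ℝ => (r : ℂ) * s) s (Ioo 0 1) 1 := by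
    have := ((hasDerivAt_id ((1 : ℝ) : ℂ)).mul_const (s : ℂ)).comp_ofReal
    simpa using this.hasDerivWithinAt
  have hmap : MapsTo (fun r : ℝ => (r : ℂ) * s) (Ioo 0 1) cDisc := fun r hr => by
    have : |s| = 1 := by rcases hs with rfl | rfl <;> norm_num
    simp [this, abs_of_pos hr.1, hr.2.le]
  have hk : HasDerivWithinAt (fun r : ℝ => ‖F (r * s)‖ ^ 2)
      (2 * (inner ℂ (F s) (fderivWithin ℝ F cDisc s s)).re) (Ioo 0 1) 1 := by
    have h1 : HasFDerivWithinAt F (fderivWithin ℝ F cDisc s) cDisc (((1 : ℝ) : ℂ) * s) := by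
      simpa using hF.hasFDerivWithinAt
    have h2 := h1.comp_hasDerivWithinAt 1 hγ hmap
    have h3 := (hasFDerivAt_norm_sq_C2 (F (((1 : ℝ) : ℂ) * s))).comp_hasDerivWithinAt 1 h2
    rw [fderiv_norm_sq_C2, Complex.ofReal_one, one_mul] at h3
    exact h3
  -- This difference is nonnegative on `(0, 1)` and vanishes at 1, so its left derivative there is
  -- at most 0.
  have hm : HasDerivWithinAt (fun r : ℝ => Real.exp (-(2 * c * (1 - r ^ 2))) - ‖F (r * s)‖ ^ 2)
      (4 * c - 2 * (inner ℂ (F s) (fderivWithin ℝ F cDisc s s)).re) (Ioo 0 1) 1 := by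
    refine HasDerivWithinAt.sub (HasDerivAt.hasDerivWithinAt ?_) hk
    have h1 : HasDerivAt (fun r : ℝ => -(2 * c * (1 - r ^ 2))) (4 * c) 1 := by
      have := (((hasDerivAt_pow 2 (1 : ℝ)).const_sub 1).const_mul (2 * c)).neg
      exact this.congr_deriv (by norm_num; ring)
    simpa using h1.exp
  have hslope := hasDerivWithinAt_iff_tendsto_slope.1 hm
  have hne : (𝓝[Ioo (0 : ℝ) 1 \ {1}] 1).NeBot := by
    rw [sdiff_singleton_eq_self (by simp), nhdsWithin_Ioo_eq_nhdsLT zero_lt_one]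
    infer_instance
  have hle0 : 4 * c - 2 * (inner ℂ (F s) (fderivWithin ℝ F cDisc s s)).re ≤ 0 := by
    refine le_of_tendsto hslope ?_
    filter_upwards [self_mem_nhdsWithin] with r hr
    have hr1 := hr.1
    have hx : r * s ∈ Ioo (-1 : ℝ) 1 := by
      rcases hs with rfl | rfl <;> constructor <;> linarith [hr1.1, hr1.2]
    have h1 := hle _ hx
    have h2 : ‖F (r * s)‖ ^ 2 ≤ Real.exp (-(2 * c * (1 - r ^ 2))) := by
      rw [Complex.ofReal_mul, mul_pow, hs2] at h1
      calc ‖F (r * s)‖ ^ 2 ≤ Real.exp (-(c * (1 - r ^ 2 * 1))) ^ 2 := by gcongr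
        _ = _ := by rw [← Real.exp_nat_mul]; congr 1; push_cast; ring
    rw [slope_def_field]
    refine div_nonpos_of_nonneg_of_nonpos ?_ (by linarith [hr1.2])
    have h3 : Real.exp (-(2 * c * (1 - (1 : ℝ) ^ 2))) - ‖F ((1 : ℝ) * s)‖ ^ 2 = 0 := by
      rw [Complex.ofReal_one, one_mul, hS]
      simp
    rw [h3]
    linarith
  linarith

/-! ### Small combinations of cone elements and boundary estimates -/

namespace IsConeElement

variable {h h₁ h₂ : ℂ → ℂ}

theorem linearCombination (hh₁ : IsConeElement h₁) (hh₂ : IsConeElement h₂) {a b : ℝ} (ha : 0 < a)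
    (hb : 0 < b) : IsConeElement fun z => a * h₁ z + b * h₂ z where
  isAInfty := ⟨(contDiffOn_const.mul hh₁.isAInfty.1).add (contDiffOn_const.mul hh₂.isAInfty.1),
    (hh₁.isAInfty.2.const_mul _).add (hh₂.isAInfty.2.const_mul _)⟩
  map_conj z := by simp [hh₁.map_conj, hh₂.map_conj]
  re_pos z hz := by
    have := hh₁.re_pos z hz
    have := hh₂.re_pos z hz
    rw [Complex.add_re, Complex.re_ofReal_mul, Complex.re_ofReal_mul]
    positivity
  re_eq_zero z hz hz' := by simp [hh₁.re_eq_zero z hz hz', hh₂.re_eq_zero z hz hz']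
  hopf := by
    obtain ⟨c, hc, hc'⟩ := hh₁.hopf
    refine ⟨a * c, by positivity, fun x hx => ?_⟩
    have h1 := mul_le_mul_of_nonneg_left (hc' x hx) ha.le
    have h2 := mul_pos hb (hh₂.re_pos x (by
      rw [Complex.norm_real, Real.norm_eq_abs, abs_lt]; exact hx))
    rw [Complex.add_re, Complex.re_ofReal_mul, Complex.re_ofReal_mul]
    linarith

theorem re_nonneg (hh : IsConeElement h) {z : ℂ} (hz : z ∈ cDisc) : 0 ≤ (h z).re := by
  have hcl : closure (ball (0 : ℂ) 1) = cDisc := closure_ball _ one_ne_zero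
  refine le_on_closure (s := ball (0 : ℂ) 1) (f := fun _ => (0 : ℝ)) (g := fun z => (h z).re)
    (fun y hy => (hh.re_pos y (by simpa using hy)).le) continuousOn_const ?_ (by rwa [hcl])
  rw [hcl]
  exact Complex.continuous_re.comp_continuousOn hh.isAInfty.1.continuousOn

theorem memHPlusStar (hh : IsConeElement h) : MemHPlusStar h := by
  have hev : ∀ s : ℂ, s.im = 0 → ∀ᶠ z in 𝓝[circ] s, (h z).re = 0 := by
    intro s hs
    have h1 : ∀ᶠ z in 𝓝 s, |z.im| < 1 / 4 := by
      have : ContinuousAt (fun z : ℂ => |z.im|) s := by fun_prop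
      exact this.tendsto.eventually_lt_const (by simp [hs])
    filter_upwards [mem_nhdsWithin_of_mem_nhds h1, self_mem_nhdsWithin] with z hz hz'
    exact hh.re_eq_zero z (by simpa using hz') (le_of_lt hz)
  refine ⟨⟨hh.isAInfty, fun z _ => hh.map_conj z, hev 1 (by simp), hev (-1) (by simp)⟩,
    fun z hz => hh.re_nonneg hz, 0, by simp, fun h0 => ?_⟩
  have := hh.re_pos 0 (by simp)
  rw [h0] at this
  simp at this

/-- The real part vanishes near `±1` on the circle, and conjugation symmetry kills the imaginary
part. Hence twisting does not move `f 1` and `f (-1)`. -/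
theorem apply_eq_zero_of_real (hh : IsConeElement h) {s : ℂ} (hs : ‖s‖ = 1) (hs' : s.im = 0) :
    h s = 0 := by
  refine Complex.ext (hh.re_eq_zero s hs (by simp [hs'])) ?_
  have h1 := hh.map_conj s
  rw [Complex.conj_eq_iff_im.2 hs'] at h1
  exact Complex.conj_eq_iff_im.1 h1.symm

theorem exists_norm_add_norm_fderivWithin_le (hh : IsConeElement h) :
    ∃ M > 0, ∀ z ∈ cDisc, ‖h z‖ + ‖fderivWithin ℝ h cDisc z‖ ≤ M := by
  have hc : ContinuousOn (fun z => ‖h z‖ + ‖fderivWithin ℝ h cDisc z‖) cDisc :=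
    hh.isAInfty.1.continuousOn.norm.add
      (hh.isAInfty.1.continuousOn_fderivWithin uniqueDiffOn_cDisc (by simp)).norm
  obtain ⟨M, hM⟩ := (isCompact_closedBall (0 : ℂ) 1).exists_bound_of_continuousOn hc
  refine ⟨max M 1, by positivity, fun z hz => ?_⟩
  exact ((Real.le_norm_self _).trans (hM z hz)).trans (le_max_left _ _)

theorem c1Small_linearCombination (hh₁ : IsConeElement h₁) (hh₂ : IsConeElement h₂) {ε : ℝ}
    (hε : 0 < ε) : ∃ δ > 0, ∀ a ∈ Ioo (0 : ℝ) δ, ∀ b ∈ Ioo (0 : ℝ) δ,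
      C1Small (fun z => a * h₁ z + b * h₂ z) ε := by
  obtain ⟨M₁, hM₁, h1⟩ := hh₁.exists_norm_add_norm_fderivWithin_le
  obtain ⟨M₂, hM₂, h2⟩ := hh₂.exists_norm_add_norm_fderivWithin_le
  refine ⟨ε / (M₁ + M₂), by positivity, fun a ha b hb z hz => ?_⟩
  have d1 := (hh₁.isAInfty.1.differentiableOn (by simp)) z hz
  have d2 := (hh₂.isAInfty.1.differentiableOn (by simp)) z hz
  have hu := uniqueDiffOn_cDisc z hz
  have hd : fderivWithin ℝ (fun z => a * h₁ z + b * h₂ z) cDisc z =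
      a • fderivWithin ℝ h₁ cDisc z + b • fderivWithin ℝ h₂ cDisc z := by
    have e : (fun z => a * h₁ z + b * h₂ z) = fun z => a • h₁ z + b • h₂ z := by
      funext z; simp
    rw [e]
    exact ((d1.hasFDerivWithinAt.const_smul a).add
      (d2.hasFDerivWithinAt.const_smul b)).fderivWithin hu
  have n1 : ‖a * h₁ z + b * h₂ z‖ ≤ a * ‖h₁ z‖ + b * ‖h₂ z‖ := by
    refine (norm_add_le _ _).trans_eq ?_
    simp [abs_of_pos ha.1, abs_of_pos hb.1]
  have n2 : ‖fderivWithin ℝ (fun z => a * h₁ z + b * h₂ z) cDisc z‖ ≤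
      a * ‖fderivWithin ℝ h₁ cDisc z‖ + b * ‖fderivWithin ℝ h₂ cDisc z‖ := by
    rw [hd]
    refine (norm_add_le _ _).trans_eq ?_
    rw [norm_smul, norm_smul, Real.norm_of_nonneg ha.1.le, Real.norm_of_nonneg hb.1.le]
  have n3 := mul_le_mul_of_nonneg_left (h1 z hz) ha.1.le
  have n4 := mul_le_mul_of_nonneg_left (h2 z hz) hb.1.le
  have n5 := mul_lt_mul_of_pos_right ha.2 hM₁
  have n6 := mul_lt_mul_of_pos_right hb.2 hM₂
  have n7 : ε / (M₁ + M₂) * M₁ + ε / (M₁ + M₂) * M₂ = ε := by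
    field_simp
  linarith

end IsConeElement

theorem eq_one_or_eq_neg_one_of_notMem {z : ℂ} (hz : z ∈ circ) (h : z ∉ circ \ {1, -1}) :
    z = ((1 : ℝ) : ℂ) ∨ z = ((-1 : ℝ) : ℂ) := by
  by_contra! h'
  refine h ⟨hz, ?_⟩
  simpa using h'

/-- A bound for the real part of the twisting function that keeps the boundary norm large. -/
theorem exists_lt_norm_twist {f : ℂ → C2} (hf : ContinuousOn f cDisc)
    (hb : ∀ z ∈ circ \ {1, -1}, 1 < ‖f z‖) {η : ℝ} (hη : η ∈ Ioo (0 : ℝ) 1) :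
    ∃ κ > 0, ∀ h, IsConeElement h → (∀ z ∈ cDisc, (h z).re < κ) → ∀ z ∈ circ \ {1, -1},
      (1 - η) * ‖f z‖ + η < ‖twist h f z‖ := by
  obtain ⟨hη0, hη1⟩ := hη
  let K : Set ℂ := circ ∩ {z | 1 / 4 ≤ |z.im|}
  have hK : IsCompact K := (isCompact_sphere _ _).inter_right
    (isClosed_le continuous_const (by fun_prop))
  have hKn : K.Nonempty := ⟨Complex.I, by simp, by simp; norm_num⟩
  have hKb : K ⊆ circ \ {1, -1} := fun z hz => by
    refine ⟨hz.1, ?_⟩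
    have h1 := hz.2
    rintro (rfl | rfl) <;> simp at h1 <;> norm_num at h1
  obtain ⟨z₀, hz₀, hmin⟩ := hK.exists_isMinOn hKn
    ((hf.mono sphere_subset_closedBall).norm.mono inter_subset_left)
  set m := ‖f z₀‖
  have hm : 1 < m := hb z₀ (hKb hz₀)
  -- The bound `Re h < η * (m - 1) / m` is equivalent to `η < (η - Re h) * m`, which is what `exp
  -- (-Re h) ≥ 1 - Re h` requires on `K`. Off `K` the norm of `f` is unchanged.
  refine ⟨η * (m - 1) / m, by have := sub_pos.2 hm; positivity, fun h hh hκ z hz => ?_⟩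
  have hfz := hb z hz
  have hz1 : ‖z‖ = 1 := by simpa using hz.1
  rw [norm_twist]
  by_cases hzK : |z.im| ≤ 1 / 4
  · rw [hh.re_eq_zero z hz1 hzK, neg_zero, Real.exp_zero]
    nlinarith
  · have hmz : m ≤ ‖f z‖ := hmin ⟨hz.1, (not_le.1 hzK).le⟩
    have hu := hκ z (sphere_subset_closedBall hz.1)
    rw [lt_div_iff₀ (by linarith)] at hu
    have he := Real.add_one_le_exp (-(h z).re)
    have hpos : 0 < η - (h z).re := by nlinarith
    have h1 : η < (η - (h z).re) * ‖f z‖ := by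
      have := mul_le_mul_of_nonneg_left hmz hpos.le
      nlinarith
    have h2 := mul_le_mul_of_nonneg_right he (norm_nonneg (f z))
    nlinarith

/-! ### Choice of generic parameters -/

theorem exists_generic_twist (f : ℂ → C2)
    (hf : IsAInfty f)
    (hf0 : ∀ z ∈ cDisc, f z ≠ 0)
    (ha : ∀ x : ℝ, x ∈ Ioo (-1 : ℝ) 1 → ‖f (x : ℂ)‖ ^ 2 ≤ 1)
    (hb : ∀ z ∈ circ \ {1, -1}, 1 < ‖f z‖)
    (hc : IsImmersionP1 (sigma ∘ f))
    (E : Set C2)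
    (hE : IsEmbeddedCurve E) (hES : E ⊆ S3)
    (hE1 : f 1 ∉ E) (hE2 : f (-1) ∉ E)
    (η : ℝ) (hη : η ∈ Ioo (0 : ℝ) 1) (ε : ℝ) (hε : 0 < ε) :
    ∃ h : ℂ → ℂ, MemHPlusStar h ∧ C1Small h ε ∧
      (∀ z ∈ cDisc, twist h f z ≠ 0) ∧
      IsImmersionC2 (twist h f) ∧
      (∀ x : ℝ, x ∈ Ioo (-1 : ℝ) 1 → ‖twist h f (x : ℂ)‖ < 1) ∧
      (∀ z ∈ circ \ {1, -1},
        (1 - η) * ‖f z‖ + η < ‖twist h f z‖ ∧ 1 < (1 - η) * ‖f z‖ + η) ∧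
      IsTransverseS3 (twist h f) ∧
      twist h f '' cDisc ∩ E = ∅ := by
  obtain ⟨h₁, h₂, hh₁, hh₂, hind⟩ := exists_isConeElement_pair
  obtain ⟨κ, hκ, hκ'⟩ := exists_lt_norm_twist hf.1.continuousOn hb hη
  obtain ⟨δ, hδ, hδ'⟩ := hh₁.c1Small_linearCombination hh₂ (lt_min hε hκ)
  have hSE := volume_setOf_twist_mem_eq_zero hf.1 hf0 hc hE hh₁.isAInfty.1 hh₂.isAInfty.1 hind
  rw [Measure.volume_eq_prod] at hSE
  -- By Fubini almost every `t₁` has a null slice of bad `t₂`. The parameter `t₁` is fixed first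
  -- because `levelRatio` depends on it.
  obtain ⟨t₁, ht₁, ht₁'⟩ := exists_mem_Ioo_notMem_of_volume_eq_zero
    (ae_iff.1 (Measure.measure_ae_null_of_prod_null hSE)) hδ
  rw [mem_ofPred_eq, not_not] at ht₁'
  have hcrit := volume_image_critical_eq_zero isOpen_ball
    (contDiffOn_infty.1
      (contDiffOn_levelRatio hf.1 hf0 hh₁.isAInfty.1 hh₂.isAInfty.1 hh₂.re_pos t₁) 3)
  obtain ⟨t₂, ht₂, ht₂'⟩ := exists_mem_Ioo_notMem_of_volume_eq_zero
    (measure_union_null ht₁' hcrit) hδ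
  rw [mem_union, not_or] at ht₂'
  obtain ⟨htE, htS⟩ := ht₂'
  have hsmall := hδ' t₁ ht₁ t₂ ht₂
  have hh := hh₁.linearCombination hh₂ ht₁.1 ht₂.1
  have htrans := fun z hz hS => exists_inner_ne_zero_of_notMem_criticalValues hf.1 hf0
    hh₁.isAInfty.1 hh₂.isAInfty.1 hh₂.re_pos htS (z := z) hz hS
  have havoid : ∀ z, ‖z‖ < 1 → z.im ≠ 0 →
      twist (fun z => t₁ * h₁ z + t₂ * h₂ z) f z ∉ E :=
    fun z hz hz' hzE => htE ⟨z, hz, hz', hzE⟩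
  generalize (fun z => (t₁ : ℂ) * h₁ z + t₂ * h₂ z) = h at hsmall hh htrans havoid
  have hreal : ∀ x ∈ Ioo (-1 : ℝ) 1, ‖twist h f x‖ ≤ Real.exp (-(h x).re) := by
    intro x hx
    rw [norm_twist]
    refine mul_le_of_le_one_right (Real.exp_pos _).le ?_
    exact (sq_le_one_iff₀ (norm_nonneg _)).1 (ha x hx)
  have hnorm : ∀ x ∈ Ioo (-1 : ℝ) 1, ‖(x : ℂ)‖ < 1 := fun x hx => by
    rw [Complex.norm_real, Real.norm_eq_abs, abs_lt]; exact hx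
  have hint : ∀ x ∈ Ioo (-1 : ℝ) 1, ‖twist h f x‖ < 1 := fun x hx =>
    (hreal x hx).trans_lt (Real.exp_lt_one_iff.2 (neg_neg_iff_pos.2 (hh.re_pos x (hnorm x hx))))
  have hreal_of_im : ∀ z : ℂ, ‖z‖ < 1 → z.im = 0 → ‖twist h f z‖ < 1 := fun z hz hz' => by
    have hzr : ((z.re : ℝ) : ℂ) = z := Complex.ext rfl (by simp [hz'])
    rw [← hzr]
    refine hint _ (abs_lt.1 ((Complex.abs_re_le_norm z).trans_lt hz))
  have hbd : ∀ z ∈ circ \ {1, -1},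
      (1 - η) * ‖f z‖ + η < ‖twist h f z‖ ∧ 1 < (1 - η) * ‖f z‖ + η := by
    intro z hz
    refine ⟨hκ' h hh (fun z hz => ?_) z hz, ?_⟩
    · have h1 := hsmall z hz
      have h2 := Complex.re_le_norm (h z)
      have h3 := norm_nonneg (fderivWithin ℝ h cDisc z)
      have h4 := min_le_right ε κ
      linarith
    · nlinarith [hb z hz, hη.1, hη.2]
  have himm := isImmersionC2_twist hf.1 hf0 hc hh.isAInfty.1
  refine ⟨h, hh.memHPlusStar, fun z hz => (hsmall z hz).trans_le (min_le_left _ _),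
    fun z hz => twist_ne_zero h (hf0 z hz), himm, hint, hbd, ?_, ?_⟩
  · intro z hz hzS w
    have hS : ‖twist h f z‖ = 1 := by simpa using hzS
    rcases lt_or_eq_of_le (show ‖z‖ ≤ 1 by simpa using hz) with hz1 | hz1
    · obtain ⟨a, ha⟩ := htrans z hz1 hS
      exact exists_apply_add_tangent_eq ha w
    -- On the circle the twisted map meets the sphere at most at `±1`, where the Hopf bound applies.
    · have hzb : z ∉ circ \ {1, -1} := fun h' => by linarith [(hbd z h').1, (hbd z h').2]
      have hs : ∃ s : ℝ, (s = 1 ∨ s = -1) ∧ z = s := by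
        rcases eq_one_or_eq_neg_one_of_notMem (by simpa using hz1) hzb with h' | h'
        · exact ⟨1, Or.inl rfl, h'⟩
        · exact ⟨-1, Or.inr rfl, h'⟩
      obtain ⟨s, hs, rfl⟩ := hs
      obtain ⟨c, hc0, hc1⟩ := hh.hopf
      refine exists_apply_add_tangent_eq (inner_fderivWithin_pos_of_norm_le hs
        ((himm.1.differentiableOn (by simp)) _ hz) hS hc0 fun x hx => ?_).ne' w
      exact (hreal x hx).trans (Real.exp_le_exp.2 (neg_le_neg (hc1 x hx)))
  · rw [eq_empty_iff_forall_notMem]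
    rintro _ ⟨⟨z, hz, rfl⟩, hzE⟩
    have hS : ‖twist h f z‖ = 1 := by simpa using hES hzE
    rcases lt_or_eq_of_le (show ‖z‖ ≤ 1 by simpa using hz) with hz1 | hz1
    -- At real points `h₁` and `h₂` are real, hence dependent, but there the image lies inside the
    -- open ball.
    · by_cases him : z.im = 0
      · exact (hreal_of_im z hz1 him).ne hS
      · exact havoid z hz1 him hzE
    · have hz2 : z = ((1 : ℝ) : ℂ) ∨ z = ((-1 : ℝ) : ℂ) :=
        eq_one_or_eq_neg_one_of_notMem (by simpa using hz1) fun h' => by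
          have := hbd z h'
          linarith [this.1, this.2]
      have him : z.im = 0 := by rcases hz2 with rfl | rfl <;> exact Complex.ofReal_im _
      have hfz : twist h f z = f z := by
        rw [twist, hh.apply_eq_zero_of_real hz1 him]
        simp
      rw [hfz] at hzE
      rcases hz2 with rfl | rfl
      · exact hE1 (by simpa using hzE)
      · exact hE2 (by simpa using hzE)

end DiscPosition

theorem lemma3p1 (f : ℂ → DiscPosition.C2)
    (hf : DiscPosition.IsAInfty f)
    (hf0 : ∀ z ∈ DiscPosition.cDisc, f z ≠ 0)
    (ha : ∀ x : ℝ, x ∈ Ioo (-1 : ℝ) 1 → ‖f (x : ℂ)‖ ^ 2 ≤ 1)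
    (hb : ∀ z ∈ DiscPosition.circ \ {1, -1}, 1 < ‖f z‖)
    (hc : DiscPosition.IsImmersionP1 (DiscPosition.sigma ∘ f))
    (E : Set DiscPosition.C2)
    (hE : DiscPosition.IsEmbeddedCurve E) (hEc : IsCompact E) (hES : E ⊆ DiscPosition.S3)
    (hE1 : f 1 ∉ E) (hE2 : f (-1) ∉ E)
    (η : ℝ) (hη : η ∈ Ioo (0 : ℝ) 1) (ε : ℝ) (hε : 0 < ε) :
    ∃ h : ℂ → ℂ, DiscPosition.MemHPlusStar h ∧ DiscPosition.C1Small h ε ∧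
      (∀ z ∈ DiscPosition.cDisc, DiscPosition.twist h f z ≠ 0) ∧
      DiscPosition.IsImmersionC2 (DiscPosition.twist h f) ∧
      (∀ x : ℝ, x ∈ Ioo (-1 : ℝ) 1 → ‖DiscPosition.twist h f (x : ℂ)‖ < 1) ∧
      (∀ z ∈ DiscPosition.circ \ {1, -1},
        (1 - η) * ‖f z‖ + η < ‖DiscPosition.twist h f z‖ ∧ 1 < (1 - η) * ‖f z‖ + η) ∧
      DiscPosition.IsTransverseS3 (DiscPosition.twist h f) ∧
      DiscPosition.twist h f '' DiscPosition.cDisc ∩ E = ∅ :=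
  DiscPosition.exists_generic_twist f hf hf0 ha hb hc E hE hES hE1 hE2 η hη ε hε
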